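/- For finite simple graphs $F$ and $H$, let $R(F,H)$ denote the smallest positive integer $N$ such that every red/blue coloring of the edges of the complete graph $K_N$ contains a red copy of $F$ or a blue copy of $H$ (as a not necessarily induced subgraph). Let $C_m$ be the cycle of length $m$, and let $F_n$ be the fan on $2n+1$ vertices consisting of $n$ triangles that share exactly one common vertex (the center) and are otherwise vertex-disjoint. Then: (i) $R(C_{2n}, F_n) = (4+o(1))\,n$ as $n\to\infty$; that is, there is a real sequence $\varepsilon_n\to 0$ such that $R(C_{2n},F_n)=(4+\varepsilon_n)n$ for all sufficiently large integers $n$; (ii) $R(C_n, F_n) = (3+o(1))\,n$ as $n\to\infty$ through the even integers; that is, there is a real sequence $\varepsilon_n\to 0$ such that $R(C_n,F_n)=(3+\varepsilon_n)n$ for all sufficiently large even integers $n$. -/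

import Mathlib

/-- `RamseyArrows F H N`: every red/blue coloring of the edges of the complete graph on `N` vertices
contains a red copy of `F` or a blue copy of `H` (not necessarily induced).
Label `1` is red and label `0` is blue. -/
def RamseyArrows {α β : Type*} (F : SimpleGraph α) (H : SimpleGraph β) (N : ℕ) : Prop :=
  ∀ C : SimpleGraph.TopEdgeLabeling (Fin N) (Fin 2),
    F.IsContained (C.labelGraph 1) ∨ H.IsContained (C.labelGraph 0)

/-- The Ramsey number `R(F, H)`: the smallest positive integer `N` such that every red/blue coloring
of the edges of `K_N` contains a red `F` or a blue `H`. -/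
noncomputable def ramseyNumber {α β : Type*} (F : SimpleGraph α) (H : SimpleGraph β) : ℕ :=
  sInf {N : ℕ | 0 < N ∧ RamseyArrows F H N}

/-- The fan `F_n`: `n` triangles sharing exactly one common vertex. The center is `none`, and the
`i`-th blade is the edge joining `some (i, false)` and `some (i, true)`. -/
def fanGraph (n : ℕ) : SimpleGraph (Option (Fin n × Bool)) where
  Adj
    | none, none => False
    | none, some _ => True
    | some _, none => True
    | some p, some q => p.1 = q.1 ∧ p.2 ≠ q.2
  symm := ⟨by
    rintro (_ | p) (_ | q) h
    · exact h
    · trivial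
    · trivial
    · exact ⟨h.1.symm, h.2.symm⟩⟩
  loopless := ⟨by
    rintro (_ | p) h
    · exact h
    · exact h.2 rfl⟩

namespace CycleFan

open Finset SimpleGraph

/-! Lower bound: colour disjoint cliques on one vertex fewer than the cycle red and everything else
blue. Two cliques leave blue bipartite, so triangle-free. With three cliques each blade of a blue
fan meets both parts that avoid the centre, so `n` blades do not fit when a part has fewer than `n`
vertices.

Upper bound for a red cycle of length `2 * m`, with `m = n` or `2 * m = n`: suppose neither graph
occurs. A blue neighbourhood contains no blue matching of `n` edges. The vertices missed by a
maximum blue matching, together with one well-chosen end of each matching edge, then carry a red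
cycle of length `2 * m` as soon as the neighbourhood exceeds `2 * n + m`
(`cycleGraph_isContained_of_not_hasMatching`). So blue degrees are at most `2 * n + m`, and red
degrees exceed `m` by a constant factor.

The regularity lemma is applied to red. If a component of the cluster graph had weight about `2 *
m`, its minimum degree would give a connected matching covering about that weight, and hence a red
cycle of length exactly `2 * m`. Thus red almost splits into pieces of size roughly between `m` and
`2 * m` (`exists_sparse_partition`), with blue almost complete between them.

Finally `fanGraph_isContained_of_sparse_partition` finds the fan. Take a typical centre and its blue
neighbours outside its piece. If these had no blue matching of `n` edges, the unmatched ones would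
lie mostly in one piece which most matching edges also meet, leaving only about `n` vertices outside
that piece. Removing any two pieces leaves more than `n` vertices, a contradiction. For `m = n` this
needs a third piece, which exists because two pieces cannot exhaust the vertex set. -/

/-- A cyclic sequence of distinct vertices with consecutive ones adjacent is a copy of a cycle. -/
theorem cycleGraph_isContained_of_seq {α : Type*} {G : SimpleGraph α} {L : ℕ} (f : ℕ → α)
    (hinj : ∀ i < L, ∀ j < L, f i = f j → i = j)
    (hadj : ∀ i, i + 1 < L → G.Adj (f i) (f (i + 1)))
    (hlast : 2 ≤ L → G.Adj (f (L - 1)) (f 0)) : (cycleGraph L).IsContained G := by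
  have key : ∀ u v : Fin L, (u - v).val = 1 → G.Adj (f v) (f u) := by
    intro u v h
    have hu := u.2
    have hv := v.2
    rw [Fin.sub_def] at h
    simp only at h
    rcases lt_or_ge (L - v.val + u.val) L with hlt | hge
    · rw [Nat.mod_eq_of_lt hlt] at h
      have h1 : v.val = L - 1 := by omega
      have h2 : u.val = 0 := by omega
      rw [h1, h2]
      exact hlast (by omega)
    · rw [Nat.mod_eq_sub_mod hge, Nat.mod_eq_of_lt (by omega)] at h
      have h1 : u.val = v.val + 1 := by omega
      rw [h1]
      exact hadj _ (by omega)
  refine ⟨⟨⟨fun i => f i, ?_⟩, ?_⟩⟩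
  · intro u v h
    rw [cycleGraph_adj'] at h
    rcases h with h | h
    · exact (key u v h).symm
    · exact key v u h
  · intro u v h
    exact Fin.ext (hinj _ u.2 _ v.2 h)

/-! ### Matchings, fans and alternating cycles. -/

/-- `g` is a matching of `G` inside `W`, indexed by `ι`: the `i`-th edge joins `g (i, false)` and
`g (i, true)`. -/
structure IsMatchingIn {α ι : Type*} (G : SimpleGraph α) (W : Finset α) (g : ι × Bool → α) :
    Prop where
  inj : Function.Injective g
  mem : ∀ x, g x ∈ W
  adj : ∀ i, G.Adj (g (i, false)) (g (i, true))

/-- `G` has a matching with `r` edges inside `W`. -/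
def HasMatching {α : Type*} (G : SimpleGraph α) (W : Finset α) (r : ℕ) : Prop :=
  ∃ g : Fin r × Bool → α, IsMatchingIn G W g

section Matching

variable {α : Type*} {G : SimpleGraph α} {W : Finset α} {r : ℕ}

theorem IsMatchingIn.hasMatching {ι : Type*} [Fintype ι] {g : ι × Bool → α}
    (hg : IsMatchingIn G W g) : HasMatching G W (Fintype.card ι) := by
  let e := (Fintype.equivFin ι).symm
  refine ⟨fun x => g (e x.1, x.2), ?_, fun x => hg.mem _, fun i => hg.adj _⟩
  rintro ⟨i, a⟩ ⟨j, b⟩ h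
  have := hg.inj h
  simpa using this

/-- A matching can be enlarged by an edge disjoint from it. -/
theorem IsMatchingIn.hasMatching_succ {g : Fin r × Bool → α} (hg : IsMatchingIn G W g) {u v : α}
    (hu : u ∈ W) (hv : v ∈ W) (hug : u ∉ Set.range g) (hvg : v ∉ Set.range g) (huv : G.Adj u v) :
    HasMatching G W (r + 1) := by
  let g' : Option (Fin r) × Bool → α
    | (none, false) => u
    | (none, true) => v
    | (some i, b) => g (i, b)
  have h : IsMatchingIn G W g' := by
    refine ⟨?_, ?_, ?_⟩
    · have huv' := huv.ne
      simp only [Set.mem_range, not_exists] at hug hvg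
      rintro ⟨_ | i, _ | _⟩ ⟨_ | j, _ | _⟩ h <;> simp only [g'] at h <;>
        first
        | rfl
        | exact absurd h huv'
        | exact absurd h.symm huv'
        | exact absurd h (hug _)
        | exact absurd h (hvg _)
        | exact absurd h.symm (hug _)
        | exact absurd h.symm (hvg _)
        | (have := hg.inj h; simp at this; try simp [this])
    · rintro ⟨_ | i, _ | _⟩ <;> simp only [g'] <;> first | assumption | exact hg.mem _
    · rintro (_ | i)
      · exact huv
      · exact hg.adj i
  simpa using h.hasMatching

/-- The endpoints of an edge of a maximum matching have no two distinct partners outside it. -/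
theorem IsMatchingIn.hasMatching_succ_of_augment {g : Fin r × Bool → α}
    (hg : IsMatchingIn G W g) {u v : α} (hu : u ∈ W) (hv : v ∈ W) (hug : u ∉ Set.range g)
    (hvg : v ∉ Set.range g) (huv : u ≠ v) (i : Fin r) (h1 : G.Adj u (g (i, false)))
    (h2 : G.Adj v (g (i, true))) : HasMatching G W (r + 1) := by
  classical
  have hne : ∀ x, g x ≠ u := fun x hx => hug ⟨x, hx⟩
  have hne' : ∀ x, g x ≠ v := fun x hx => hvg ⟨x, hx⟩
  -- Augmenting path: `u` takes the place of `g (i, true)` in edge `i`, which frees `g (i, true)` to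
  -- be matched with `v`.
  let g' := Function.update g (i, true) u
  have hg'1 : g' (i, true) = u := by simp [g']
  have hg'2 : ∀ x, x ≠ (i, true) → g' x = g x := fun x hx => by simp [g', hx]
  have hg' : IsMatchingIn G W g' := by
    refine ⟨?_, ?_, ?_⟩
    · intro x y hxy
      by_cases hx : x = (i, true) <;> by_cases hy : y = (i, true)
      · rw [hx, hy]
      · rw [hx, hg'1, hg'2 y hy] at hxy
        exact absurd hxy.symm (hne y)
      · rw [hy, hg'1, hg'2 x hx] at hxy
        exact absurd hxy (hne x)
      · rw [hg'2 x hx, hg'2 y hy] at hxy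
        exact hg.inj hxy
    · intro x
      by_cases hx : x = (i, true)
      · rw [hx, hg'1]; exact hu
      · rw [hg'2 x hx]; exact hg.mem x
    · intro j
      by_cases hj : j = i
      · subst hj
        rw [hg'1, hg'2 _ (by simp)]
        exact h1.symm
      · rw [hg'2 _ (by simp), hg'2 _ (by simp [hj])]
        exact hg.adj j
  refine hg'.hasMatching_succ hv (hg.mem (i, true)) ?_ ?_ h2
  · rintro ⟨x, hx⟩
    by_cases hxi : x = (i, true)
    · rw [hxi, hg'1] at hx; exact huv hx
    · rw [hg'2 x hxi] at hx; exact hne' x hx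
  · rintro ⟨x, hx⟩
    by_cases hxi : x = (i, true)
    · rw [hxi, hg'1] at hx; exact hne _ hx.symm
    · rw [hg'2 x hxi] at hx; exact hxi (hg.inj hx)

/-- If there is no matching with `n` edges, there is a matching with fewer edges that cannot be
enlarged. -/
theorem exists_maximum_matching (G : SimpleGraph α) (W : Finset α) {n : ℕ}
    (h : ¬ HasMatching G W n) :
    ∃ r < n, ∃ g : Fin r × Bool → α, IsMatchingIn G W g ∧ ¬ HasMatching G W (r + 1) := by
  classical
  have hex : ∃ k, ¬ HasMatching G W k := ⟨n, h⟩
  have h0 : HasMatching G W 0 := ⟨fun x => x.1.elim0, fun x => x.1.elim0, fun x => x.1.elim0,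
    fun i => i.elim0⟩
  have hpos : Nat.find hex ≠ 0 := fun h0' => Nat.find_spec hex (h0' ▸ h0)
  obtain ⟨r, hr⟩ := Nat.exists_eq_succ_of_ne_zero hpos
  have hle := Nat.find_min' hex h
  have hrm : HasMatching G W r := by
    by_contra hcon
    have := Nat.find_min' hex hcon
    omega
  obtain ⟨g, hg⟩ := hrm
  refine ⟨r, by omega, g, hg, ?_⟩
  have := Nat.find_spec hex
  rwa [hr] at this

/-- The structure around a maximum matching: the uncovered vertices form an independent set, and
every matching edge has an endpoint with at most one neighbour among them. -/
theorem exists_matching_structure [DecidableEq α] (G : SimpleGraph α) [DecidableRel G.Adj]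
    (W : Finset α) {n : ℕ} (h : ¬ HasMatching G W n) :
    ∃ r < n, ∃ g : Fin r × Bool → α, ∃ U : Finset α, IsMatchingIn G W g ∧
      U ⊆ W ∧ (∀ u, u ∈ U ↔ u ∈ W ∧ u ∉ Set.range g) ∧ U.card + 2 * r = W.card ∧
      (∀ u ∈ U, ∀ v ∈ U, ¬ G.Adj u v) ∧
      ∀ i, (U.filter fun u => G.Adj (g (i, false)) u).card ≤ 1 := by
  obtain ⟨r, hr, g, hg, hmax⟩ := exists_maximum_matching G W h
  have hind : ∀ u ∈ W, u ∉ Set.range g → ∀ v ∈ W, v ∉ Set.range g → ¬ G.Adj u v :=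
    fun u hu hug v hv hvg huv => hmax (hg.hasMatching_succ hu hv hug hvg huv)
  let U := W \ univ.image g
  have hU : ∀ u, u ∈ U ↔ u ∈ W ∧ u ∉ Set.range g := by
    intro u; simp [U]
  -- Edges whose first end has at least two neighbours in `U` get reversed. If the other end had
  -- even one neighbour there, two distinct partners could be chosen and the matching augmented.
  let bad : Fin r → Bool := fun i =>
    decide (1 < (U.filter fun u => G.Adj (g (i, false)) u).card)
  let e : Fin r × Bool → Fin r × Bool := fun x => (x.1, xor (bad x.1) x.2)
  have he : Function.Involutive e := by
    rintro ⟨i, b⟩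
    simp [e]
  have hrange : Set.range (g ∘ e) = Set.range g := he.surjective.range_comp g
  refine ⟨r, hr, g ∘ e, U, ⟨hg.inj.comp he.injective, fun x => hg.mem _, ?_⟩, sdiff_subset,
    ?_, ?_, ?_, ?_⟩
  · intro i
    cases hb : bad i
    · simpa [e, hb] using hg.adj i
    · simpa [e, hb] using (hg.adj i).symm
  · rw [hrange]; exact hU
  · have : (univ.image g).card = 2 * r := by
      rw [card_image_of_injective _ hg.inj]
      simp [mul_comm]
    have hsub : univ.image g ⊆ W := by
      intro x hx
      obtain ⟨y, -, rfl⟩ := mem_image.1 hx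
      exact hg.mem y
    rw [card_sdiff_of_subset hsub, this]
    have := card_le_card hsub
    omega
  · intro u hu v hv
    rw [hU] at hu hv
    exact hind u hu.1 hu.2 v hv.1 hv.2
  · intro i
    cases hb : bad i
    · have hb' : ¬ 1 < (U.filter fun u => G.Adj (g (i, false)) u).card := by
        simpa only [bad, decide_eq_false_iff_not] using hb
      simp only [Function.comp, e, hb, Bool.xor_false]
      omega
    · simp only [Function.comp, e, hb, Bool.xor_false]
      have hb' : 1 < (U.filter fun u => G.Adj (g (i, false)) u).card := by simpa [bad] using hb
      by_contra hcon
      obtain ⟨a, ha⟩ := card_pos.1 (zero_lt_one.trans (not_le.1 hcon))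
      obtain ⟨b, hb, hba⟩ := exists_mem_ne hb' a
      rw [mem_filter, hU] at ha hb
      exact hmax (hg.hasMatching_succ_of_augment hb.1.1 ha.1.1 hb.1.2 ha.1.2 hba i hb.2.symm
        ha.2.symm)

/-- A set in which every vertex has at least `t` neighbours contains a matching with `t` edges,
provided it has at least `2 * t` vertices. -/
theorem hasMatching_of_minDegree [DecidableEq α] [DecidableRel G.Adj] (W : Finset α) (t : ℕ)
    (hW : 2 * t ≤ W.card) (hdeg : ∀ u ∈ W, t ≤ (W.filter fun v => G.Adj u v).card) :
    HasMatching G W t := by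
  by_contra h
  obtain ⟨r, hr, g, hg, hmax⟩ := exists_maximum_matching G W h
  have hcard : (univ.image g).card = 2 * r := by
    rw [card_image_of_injective _ hg.inj]
    simp [mul_comm]
  have hlt : 1 < (W \ univ.image g).card := by
    have := le_card_sdiff (univ.image g) W
    omega
  obtain ⟨u, hu, v, hv, huv⟩ := one_lt_card.1 hlt
  have hmem : ∀ x, x ∈ W \ univ.image g → x ∈ W ∧ x ∉ Set.range g := by
    intro x hx; simpa using hx
  have hu := hmem u hu
  have hv := hmem v hv
  have hdegle : ∀ x, x ∈ W ∧ x ∉ Set.range g → (W.filter fun v => G.Adj x v).card ≤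
      ∑ i : Fin r, ((if G.Adj x (g (i, false)) then 1 else 0) +
        if G.Adj x (g (i, true)) then 1 else 0) := by
    intro x hx
    have hsub : (W.filter fun v => G.Adj x v) ⊆
        (univ.filter fun y => G.Adj x (g y)).image g := by
      intro y hy
      rw [mem_filter] at hy
      by_cases hyg : y ∈ Set.range g
      · obtain ⟨z, rfl⟩ := hyg
        exact mem_image_of_mem _ (by simpa using hy.2)
      · exact absurd (hg.hasMatching_succ hx.1 hy.1 hx.2 hyg hy.2) hmax
    refine (card_le_card hsub).trans (card_image_le.trans ?_)
    rw [card_filter, Fintype.sum_prod_type]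
    refine sum_le_sum fun i _ => ?_
    rw [Fintype.sum_bool, add_comm]
  -- Neighbours of the uncovered vertices `u`, `v` are all covered, and by augmentation each
  -- matching edge receives at most two edges from `{u, v}`. The two degrees then sum to at most `2
  -- * r < 2 * t`.
  have hsum : ∑ i : Fin r, (((if G.Adj u (g (i, false)) then 1 else 0) +
        if G.Adj u (g (i, true)) then 1 else 0) + ((if G.Adj v (g (i, false)) then 1 else 0) +
        if G.Adj v (g (i, true)) then 1 else 0)) ≤ ∑ _i : Fin r, 2 := by
    refine sum_le_sum fun i _ => ?_
    have h1 : ¬ (G.Adj u (g (i, false)) ∧ G.Adj v (g (i, true))) := fun hh =>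
      hmax (hg.hasMatching_succ_of_augment hu.1 hv.1 hu.2 hv.2 huv i hh.1 hh.2)
    have h2 : ¬ (G.Adj v (g (i, false)) ∧ G.Adj u (g (i, true))) := fun hh =>
      hmax (hg.hasMatching_succ_of_augment hv.1 hu.1 hv.2 hu.2 huv.symm i hh.1 hh.2)
    by_cases a : G.Adj u (g (i, false)) <;> by_cases b : G.Adj u (g (i, true)) <;>
      by_cases c : G.Adj v (g (i, false)) <;> by_cases d : G.Adj v (g (i, true)) <;>
      simp_all
  rw [sum_add_distrib] at hsum
  have a1 := (hdeg u hu.1).trans (hdegle u hu)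
  have a2 := (hdeg v hv.1).trans (hdegle v hv)
  simp only [sum_const, card_univ, Fintype.card_fin, smul_eq_mul] at hsum
  omega

end Matching

/-- A matching with `n` edges in the neighbourhood of a vertex gives a fan with `n` blades. -/
theorem fanGraph_isContained_of_hasMatching {α : Type*} {B : SimpleGraph α} {W : Finset α} {n : ℕ}
    {v : α} (hv : ∀ w ∈ W, B.Adj v w) (h : HasMatching B W n) : (fanGraph n).IsContained B := by
  obtain ⟨g, hg⟩ := h
  refine ⟨⟨⟨fun x => x.elim v g, ?_⟩, ?_⟩⟩
  · rintro (_ | ⟨i, a⟩) (_ | ⟨j, b⟩) h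
    · exact absurd h (fanGraph n).irrefl
    · exact hv _ (hg.mem _)
    · exact (hv _ (hg.mem _)).symm
    · obtain ⟨hij, hab⟩ : i = j ∧ a ≠ b := h
      subst hij
      cases a <;> cases b
      · exact absurd rfl hab
      · exact hg.adj i
      · exact (hg.adj i).symm
      · exact absurd rfl hab
  · rintro (_ | x) (_ | y) h
    · rfl
    · exact absurd h (hv _ (hg.mem y)).ne
    · exact absurd h (hv _ (hg.mem x)).ne'
    · exact congrArg some (hg.inj h)

/-- If each of `m` vertices is adjacent to all but at most one vertex of a disjoint set of size
`m + 2`, there is a cycle of length `2 * m` alternating between the two sets. -/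
theorem cycleGraph_isContained_of_alternating {α : Type*} [DecidableEq α] {R : SimpleGraph α}
    [DecidableRel R.Adj] {m : ℕ} (hm : 2 ≤ m) (Y U : Finset α) (hY : Y.card = m)
    (hU : m + 2 ≤ U.card) (hYU : Disjoint Y U)
    (h : ∀ y ∈ Y, (U.filter fun u => ¬ R.Adj y u).card ≤ 1) :
    (cycleGraph (2 * m)).IsContained R := by
  have hm0 : 0 < m := by omega
  let e := (Y.equivFinOfCardEq hY).symm
  let y : ℕ → α := fun i => e ⟨i % m, Nat.mod_lt _ hm0⟩
  have hyY : ∀ i, y i ∈ Y := fun i => (e _).2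
  have hyinj : ∀ i j, y i = y j → i % m = j % m := by
    intro i j hij
    have := e.injective (Subtype.ext hij)
    simpa using this
  -- Candidates for the vertex placed between `y i` and `y (i + 1)`. Each of the two excludes at
  -- most one vertex of `U`, so at least `m` remain and Hall's condition is immediate.
  let T : Fin m → Finset α := fun i =>
    (U.filter fun u => R.Adj (y i) u).filter fun u => R.Adj (y (i + 1)) u
  have hT : ∀ i, m ≤ (T i).card := by
    intro i
    have h1 := h _ (hyY i)
    have h2 := h _ (hyY (i + 1))
    have h3 : U ⊆ T i ∪ ((U.filter fun u => ¬ R.Adj (y i) u) ∪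
        (U.filter fun u => ¬ R.Adj (y (i + 1)) u)) := by
      intro u hu
      simp only [T, mem_union, mem_filter]
      tauto
    have h4 := (card_le_card h3).trans (card_union_le _ _)
    have h5 := card_union_le (U.filter fun u => ¬ R.Adj (y i) u)
      (U.filter fun u => ¬ R.Adj (y (i + 1)) u)
    omega
  obtain ⟨z, hzinj, hz⟩ := (Finset.all_card_le_biUnion_card_iff_exists_injective T).1 (by
    intro s
    rcases s.eq_empty_or_nonempty with rfl | ⟨i, hi⟩
    · simp
    · calc s.card ≤ m := by simpa using card_le_univ s
        _ ≤ (T i).card := hT i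
        _ ≤ _ := card_le_card (subset_biUnion_of_mem T hi))
  have hz' : ∀ i, z i ∈ U ∧ R.Adj (y i) (z i) ∧ R.Adj (y (i + 1)) (z i) := by
    intro i
    have := hz i
    simp only [T, mem_filter] at this
    tauto
  have hne : ∀ i j, y i ≠ z j := fun i j hij =>
    (Finset.disjoint_left.1 hYU) (hyY i) (hij ▸ (hz' j).1)
  let f : ℕ → α := fun j => if j % 2 = 0 then y (j / 2) else
    z ⟨(j / 2) % m, Nat.mod_lt _ hm0⟩
  refine cycleGraph_isContained_of_seq f ?_ ?_ ?_
  · intro i hi j hj hij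
    simp only [f] at hij
    split_ifs at hij with h1 h2 h2
    · have := hyinj _ _ hij
      rw [Nat.mod_eq_of_lt (by omega), Nat.mod_eq_of_lt (by omega)] at this
      omega
    · exact absurd hij (hne _ _)
    · exact absurd hij.symm (hne _ _)
    · have := hzinj hij
      simp only [Fin.mk.injEq] at this
      rw [Nat.mod_eq_of_lt (by omega), Nat.mod_eq_of_lt (by omega)] at this
      omega
  · intro i hi
    have hi2 : i / 2 % m = i / 2 := Nat.mod_eq_of_lt (by omega)
    rcases Nat.mod_two_eq_zero_or_one i with h0 | h1
    · have e1 : (i + 1) % 2 = 1 := by omega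
      have e2 : (i + 1) / 2 = i / 2 := by omega
      simp only [f, h0, e1, e2, hi2, if_true, one_ne_zero, if_false]
      exact (hz' ⟨i / 2, _⟩).2.1
    · have e1 : (i + 1) % 2 = 0 := by omega
      have e2 : (i + 1) / 2 = i / 2 + 1 := by omega
      simp only [f, h1, e1, e2, hi2, if_true, one_ne_zero, if_false]
      exact (hz' ⟨i / 2, _⟩).2.2.symm
  · intro _
    have e1 : (2 * m - 1) % 2 = 1 := by omega
    have e2 : (2 * m - 1) / 2 = m - 1 := by omega
    have e3 : (m - 1) % m = m - 1 := Nat.mod_eq_of_lt (by omega)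
    have e4 : y 0 = y (m - 1 + 1) := by
      simp [y, Nat.sub_add_cancel (by omega : 1 ≤ m)]
    simp only [f, e1, e2, e3, one_ne_zero, if_false, Nat.zero_mod, if_true, Nat.zero_div]
    rw [e4]
    exact (hz' ⟨m - 1, by omega⟩).2.2.symm

/-- A set of size `2 * n + m + 1` contains a blue matching with `n` edges or a red cycle of length
`2 * m`. -/
theorem cycleGraph_isContained_of_not_hasMatching {α : Type*} [DecidableEq α]
    {R B : SimpleGraph α} (hRB : ∀ x y, x ≠ y → ¬ B.Adj x y → R.Adj x y) {m n : ℕ} (hm : 2 ≤ m)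
    (hmn : m ≤ n) (W : Finset α) (hW : 2 * n + m + 1 ≤ W.card) (h : ¬ HasMatching B W n) :
    (cycleGraph (2 * m)).IsContained R := by
  classical
  obtain ⟨r, hr, g, U, hg, -, hU, hUcard, hind, hone⟩ := exists_matching_structure B W h
  -- Each vertex of `X` has at most one blue neighbour in `U`, and each vertex of `U` has none. One
  -- side of the cycle uses `X`, topped up from `U` if `r < m`; the rest of `U` is large enough for
  -- the other side because `r < n` and `m ≤ n`.
  let X : Finset α := univ.image fun i : Fin r => g (i, false)
  have hX : X.card = r := by
    rw [card_image_of_injective _ fun i j hij => by simpa using hg.inj hij]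
    simp
  have hXU : Disjoint X U := by
    rw [Finset.disjoint_left]
    intro x hx hxU
    obtain ⟨i, -, rfl⟩ := mem_image.1 hx
    exact ((hU _).1 hxU).2 ⟨_, rfl⟩
  obtain ⟨X', hX'sub, hX'⟩ := exists_subset_card_eq (show min m r ≤ X.card by omega)
  obtain ⟨U', hU'sub, hU'⟩ := exists_subset_card_eq (show m - min m r ≤ U.card by omega)
  have hX'U : Disjoint X' U := hXU.mono_left hX'sub
  refine cycleGraph_isContained_of_alternating hm (X' ∪ U') (U \ U') ?_ ?_ ?_ ?_
  · rw [card_union_of_disjoint (hX'U.mono_right hU'sub)]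
    omega
  · rw [card_sdiff_of_subset hU'sub]
    omega
  · rw [disjoint_union_left]
    exact ⟨hX'U.mono_right sdiff_subset, disjoint_sdiff⟩
  · intro y hy
    have hyne : ∀ u ∈ U \ U', y ≠ u := by
      rintro u hu rfl
      rcases mem_union.1 hy with hy | hy
      · exact Finset.disjoint_left.1 hX'U hy (mem_sdiff.1 hu).1
      · exact (mem_sdiff.1 hu).2 hy
    have hsub : ((U \ U').filter fun u => ¬ R.Adj y u) ⊆ U.filter fun u => B.Adj y u := by
      intro u hu
      rw [mem_filter] at hu ⊢
      refine ⟨(mem_sdiff.1 hu.1).1, ?_⟩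
      by_contra hB
      exact hu.2 (hRB _ _ (hyne u hu.1) hB)
    refine (card_le_card hsub).trans ?_
    rcases mem_union.1 hy with hy | hy
    · obtain ⟨i, -, rfl⟩ := mem_image.1 (hX'sub hy)
      exact hone i
    · rw [filter_false_of_mem fun u hu => hind _ (hU'sub hy) _ hu]
      simp

/-! ### Colourings for the lower bounds. -/

/-- The disjoint union of cliques on consecutive blocks of `s` vertices. -/
def blockGraph (N s : ℕ) : SimpleGraph (Fin N) where
  Adj x y := x ≠ y ∧ x.val / s = y.val / s
  symm := ⟨fun _ _ h => ⟨h.1.symm, h.2.symm⟩⟩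
  loopless := ⟨fun _ h => h.1 rfl⟩

theorem card_filter_div_eq_le (N s c : ℕ) (hs : 0 < s) :
    (univ.filter fun x : Fin N => x.val / s = c).card ≤ s := by
  have : ((univ.filter fun x : Fin N => x.val / s = c).image Fin.val).card ≤
      (Ico (c * s) (c * s + s)).card := by
    refine card_le_card fun x hx => ?_
    obtain ⟨y, hy, rfl⟩ := mem_image.1 hx
    rw [mem_filter] at hy
    have h1 := Nat.div_add_mod y.val s
    have h2 := Nat.mod_lt y.val hs
    rw [hy.2, mul_comm] at h1
    rw [mem_Ico]
    omega
  rwa [card_image_of_injective _ Fin.val_injective, Nat.card_Ico, Nat.add_sub_cancel_left] at this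

/-- A cycle is connected, so its image stays in a single block, which has only `L - 1` vertices. -/
theorem not_cycleGraph_isContained_blockGraph {N L : ℕ} (hL : 2 ≤ L) :
    ¬ (cycleGraph L).IsContained (blockGraph N (L - 1)) := by
  rintro ⟨f⟩
  obtain ⟨k, rfl⟩ : ∃ k, L = k + 1 := ⟨L - 1, by omega⟩
  have hconst : ∀ i : Fin (k + 1), (f i).val / (k + 1 - 1) = (f 0).val / (k + 1 - 1) := by
    intro i
    obtain ⟨w⟩ := (cycleGraph_connected (n := k)).preconnected i 0
    have : ∀ (u v : Fin (k + 1)) (_ : (cycleGraph (k + 1)).Walk u v),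
        (f u).val / (k + 1 - 1) = (f v).val / (k + 1 - 1) := by
      intro u v w
      induction w with
      | nil => rfl
      | cons h _ ih => exact (f.toHom.map_adj h).2.trans ih
    exact this _ _ w
  have h1 := card_filter_div_eq_le N (k + 1 - 1) ((f 0).val / (k + 1 - 1)) (by omega)
  have h2 : (univ.image f : Finset (Fin N)) ⊆
      univ.filter fun x : Fin N => x.val / (k + 1 - 1) = (f 0).val / (k + 1 - 1) := by
    intro x hx
    obtain ⟨i, -, rfl⟩ := mem_image.1 hx
    simpa using hconst i
  have h3 := card_le_card h2
  rw [card_image_of_injective _ (show Function.Injective ⇑f from f.injective)] at h3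
  simp at h3 h1
  omega

/-- For `b = 0` there are two blocks, and a single blade would already be a triangle in a bipartite
graph. For `b = 1` every blade has an end in a fixed block `d` different from the block of the
centre, which forces `n ≤ s`. -/
theorem not_fanGraph_isContained_compl_blockGraph {N s n b : ℕ} (hs : 0 < s)
    (hN : N ≤ (b + 2) * s) (hb : b = 0 ∨ b = 1) (hbn : b * s < n) :
    ¬ (fanGraph n).IsContained (blockGraph N s)ᶜ := by
  rintro ⟨f⟩
  let c : Option (Fin n × Bool) → ℕ := fun x => (f x).val / s
  have hc : ∀ x y, (fanGraph n).Adj x y → c x ≠ c y := by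
    intro x y h heq
    have := f.toHom.map_adj h
    rw [compl_adj] at this
    exact this.2 ⟨this.1, heq⟩
  have hcb : ∀ x, c x < b + 2 := fun x =>
    Nat.div_lt_of_lt_mul (by rw [mul_comm]; exact (f x).2.trans_le hN)
  have h1 : ∀ i, c none ≠ c (some (i, false)) := fun i => hc _ _ trivial
  have h2 : ∀ i, c none ≠ c (some (i, true)) := fun i => hc _ _ trivial
  have h3 : ∀ i, c (some (i, false)) ≠ c (some (i, true)) := fun i =>
    hc _ _ (show _ ∧ _ from ⟨rfl, by simp⟩)
  have hn : 0 < n := by omega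
  rcases hb with rfl | rfl
  · have := h1 ⟨0, hn⟩
    have := h2 ⟨0, hn⟩
    have := h3 ⟨0, hn⟩
    have := hcb none
    have := hcb (some (⟨0, hn⟩, false))
    have := hcb (some (⟨0, hn⟩, true))
    omega
  · obtain ⟨d, hd⟩ : ∃ d, ∀ i, c (some (i, false)) = d ∨ c (some (i, true)) = d := by
      have h0 := hcb none
      refine ⟨if c none = 0 then 1 else 0, fun i => ?_⟩
      have := h1 i
      have := h2 i
      have := h3 i
      have := hcb (some (i, false))
      have := hcb (some (i, true))
      split_ifs <;> omega
    have hch : ∀ i, ∃ t : Bool, c (some (i, t)) = d := fun i =>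
      (hd i).elim (fun h => ⟨_, h⟩) fun h => ⟨_, h⟩
    choose t ht using hch
    have h4 : (univ.image fun i : Fin n => f (some (i, t i))) ⊆
        univ.filter fun x : Fin N => x.val / s = d := by
      intro x hx
      obtain ⟨i, -, rfl⟩ := mem_image.1 hx
      simpa using ht i
    have h5 := (card_le_card h4).trans (card_filter_div_eq_le N s d hs)
    rw [card_image_of_injective _ fun i j hij => by
      have := f.injective hij
      simp only [Option.some.injEq, Prod.mk.injEq] at this
      exact this.1] at h5
    simp at h5
    omega

theorem not_ramseyArrows_of_le {N L n b : ℕ} (hL : 2 ≤ L) (hN : N ≤ (b + 2) * (L - 1))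
    (hb : b = 0 ∨ b = 1) (hbn : b * (L - 1) < n) :
    ¬ RamseyArrows (cycleGraph L) (fanGraph n) N := by
  classical
  intro h
  rcases h (blockGraph N (L - 1)).toTopEdgeLabeling with h | h
  · rw [toTopEdgeLabeling_labelGraph] at h
    exact not_cycleGraph_isContained_blockGraph hL h
  · rw [toTopEdgeLabeling_labelGraph_compl] at h
    exact not_fanGraph_isContained_compl_blockGraph (by omega) hN hb hbn h

/-! ### Closed walks of prescribed even length. -/

section Walks

variable {ι : Type*} [DecidableEq ι] {R : SimpleGraph ι}

/-- Dropping the initial vertex makes multiplicities additive, since the junction is counted once.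
-/
theorem count_tail_support_append {u v w : ι} (p : R.Walk u v) (q : R.Walk v w) (x : ι) :
    (p.append q).support.tail.count x = p.support.tail.count x + q.support.tail.count x := by
  rw [Walk.tail_support_append, List.count_append]

theorem count_tail_support_le_length {u v : ι} (p : R.Walk u v) (x : ι) :
    p.support.tail.count x ≤ p.length := by
  refine List.count_le_length.trans ?_
  simp

/-- The closed walk going back and forth along an edge. -/
theorem exists_walk_back_and_forth {a b : ι} (h : R.Adj a b) (T : ℕ) :
    ∃ p : R.Walk a a, p.length = 2 * T ∧
      ∀ x, p.support.tail.count x ≤ if x = a ∨ x = b then T else 0 := by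
  induction T with
  | zero => exact ⟨Walk.nil, by simp, by simp⟩
  | succ T ih =>
    obtain ⟨p, hp, hc⟩ := ih
    refine ⟨Walk.cons h (Walk.cons h.symm p), by simp [hp]; ring, fun x => ?_⟩
    have hx := hc x
    have hab := h.ne
    rw [Walk.support_cons, List.tail_cons, Walk.support_cons, ← Walk.cons_tail_support p,
      List.count_cons, List.count_cons]
    by_cases h1 : x = a
    · subst h1
      simp [hab.symm] at hx ⊢
      omega
    · by_cases h2 : x = b
      · subst h2
        simp [hab] at hx ⊢
        omega
      · simp [h1, h2, Ne.symm h1, Ne.symm h2] at hx ⊢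
        exact hx

/-- Given matching edges reachable from `s`, there are closed walks at `s` of every even length in
a long interval which spend nearly all their time on the matching edges, visiting each of their
endpoints about equally often. -/
theorem exists_closed_walk [Fintype ι] {κ : Type*} [DecidableEq κ] (s : ι) (g : κ × Bool → ι)
    (hinj : Function.Injective g) (hadj : ∀ i, R.Adj (g (i, false)) (g (i, true)))
    (hreach : ∀ i, R.Reachable s (g (i, false))) (cap : ℕ) (J : Finset κ) :
    ∃ Q ≤ J.card * Fintype.card ι, ∀ T ≤ J.card * cap, ∃ p : R.Walk s s,
      p.length = 2 * (T + Q) ∧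
      ∀ x, p.support.tail.count x ≤ 2 * Q + if ∃ j ∈ J, ∃ b, x = g (j, b) then cap else 0 := by
  classical
  induction J using Finset.induction_on with
  | empty =>
    refine ⟨0, by simp, fun T hT => ⟨Walk.nil, ?_, by simp⟩⟩
    simp at hT
    simp [hT]
  | insert j J hj ih =>
    obtain ⟨Q, hQ, ih⟩ := ih
    obtain ⟨q, hq⟩ := (hreach j).exists_isPath
    have hql := hq.length_lt
    rw [card_insert_of_notMem hj]
    refine ⟨Q + q.length, by rw [add_mul]; omega, fun T hT => ?_⟩
    -- Up to `cap` round trips are spent on edge `j`, the rest on `J`. The path `q` to edge `j` is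
    -- retraced on the way back, so the detour has even length and costs exactly `q.length` in `Q`.
    obtain ⟨p, hp, hpc⟩ := ih (T - min T cap) (by rw [add_mul] at hT; omega)
    obtain ⟨l, hl, hlc⟩ := exists_walk_back_and_forth (hadj j) (min T cap)
    refine ⟨p.append (q.append (l.append q.reverse)), ?_, fun x => ?_⟩
    · simp only [Walk.length_append, Walk.length_reverse, hp, hl]
      omega
    · rw [count_tail_support_append, count_tail_support_append, count_tail_support_append]
      have h1 := hpc x
      have h2 := hlc x
      have h3 := count_tail_support_le_length q x
      have h4 := count_tail_support_le_length q.reverse x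
      rw [Walk.length_reverse] at h4
      by_cases hx : x = g (j, false) ∨ x = g (j, true)
      · rw [if_pos hx] at h2
        have hx1 : ∃ i ∈ insert j J, ∃ b, x = g (i, b) :=
          hx.elim (fun h => ⟨j, mem_insert_self _ _, _, h⟩) fun h => ⟨j, mem_insert_self _ _, _, h⟩
        have hx2 : ¬ ∃ i ∈ J, ∃ b, x = g (i, b) := by
          rintro ⟨i, hi, b, hb⟩
          have hij : i ≠ j := fun h => hj (h ▸ hi)
          rcases hx with hx | hx <;> rw [hx] at hb <;> have := hinj hb <;>
            simp only [Prod.mk.injEq] at this <;> exact hij this.1.symm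
        rw [if_pos hx1]
        rw [if_neg hx2] at h1
        omega
      · rw [if_neg hx] at h2
        by_cases hx2 : ∃ i ∈ J, ∃ b, x = g (i, b)
        · have hx1 : ∃ i ∈ insert j J, ∃ b, x = g (i, b) := by
            obtain ⟨i, hi, hb⟩ := hx2
            exact ⟨i, mem_insert_of_mem hi, hb⟩
          rw [if_pos hx1]
          rw [if_pos hx2] at h1
          omega
        · rw [if_neg hx2] at h1
          omega

theorem card_filter_getVert_eq {u v : ι} (p : R.Walk u v) (x : ι) :
    ((range (p.length + 1)).filter fun i => p.getVert i = x).card = p.support.count x := by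
  induction p with
  | @nil a =>
    rw [Walk.support_nil, List.count_singleton, card_filter]
    by_cases h : a = x <;> simp [h]
  | @cons a b c h p ih =>
    rw [Walk.support_cons, List.count_cons, ← ih, card_filter, card_filter, sum_range_succ',
      Walk.length_cons]
    simp only [Walk.getVert_cons_succ, Walk.getVert_zero]
    by_cases hx : a = x <;> simp [hx, -sum_boole] <;> rfl

end Walks

/-! ### Embedding a cycle along a closed walk of clusters. -/

/-- Greedy embedding of a cycle along a closed walk in a cluster graph. Here `s` is a size that
guarantees an edge between subsets of adjacent clusters, and all but fewer than `s` vertices of a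
cluster have at least `2 * s` neighbours in any subset of size `h` of an adjacent cluster. -/
theorem cycleGraph_isContained_of_closed_walk {α ι : Type*} [DecidableEq α] [DecidableEq ι]
    {G : SimpleGraph α} [DecidableRel G.Adj] {R : SimpleGraph ι} (V : ι → Finset α)
    (hdisj : ∀ a b, a ≠ b → Disjoint (V a) (V b)) {s h : ℕ} (hs : 0 < s)
    (hedge : ∀ a b, R.Adj a b → ∀ X ⊆ V a, ∀ Y ⊆ V b, s ≤ X.card → s ≤ Y.card →
      ∃ x ∈ X, ∃ y ∈ Y, G.Adj x y)
    (hdeg : ∀ a b, R.Adj a b → ∀ X ⊆ V a, ∀ Y ⊆ V b, s ≤ X.card → h ≤ Y.card →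
      ∃ x ∈ X, 2 * s ≤ (Y.filter fun y => G.Adj x y).card)
    {o : ι} (p : R.Walk o o) (hlen : 4 ≤ p.length)
    (hcount : ∀ a ∈ p.support, p.support.count a + 2 * s + h ≤ (V a).card) :
    (cycleGraph p.length).IsContained G := by
  classical
  set L := p.length with hL
  let u : ℕ → ι := p.getVert
  have huadj : ∀ i < L, R.Adj (u i) (u (i + 1)) := fun i hi => p.adj_getVert_succ hi
  have hu0 : u 0 = o := p.getVert_zero
  have huL : u L = o := p.getVert_length
  have husupp : ∀ i, u i ∈ p.support := fun i => p.getVert_mem_support i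
  have hVu : ∀ i, 2 * s + h ≤ (V (u i)).card := fun i => by
    have := hcount _ (husupp i); omega
  have hlastadj : R.Adj (u 0) (u (L - 1)) := by
    have := huadj (L - 1) (by omega)
    rw [Nat.sub_add_cancel (by omega), huL, ← hu0] at this
    exact this.symm
  obtain ⟨x₀, hx₀, hx₀1, hx₀2⟩ : ∃ x₀ ∈ V (u 0),
      2 * s ≤ ((V (u 1)).filter fun y => G.Adj x₀ y).card ∧
      2 * s ≤ ((V (u (L - 1))).filter fun y => G.Adj x₀ y).card := by
    by_contra hcon
    push Not at hcon
    let X := (V (u 0)).filter fun x => 2 * s ≤ ((V (u 1)).filter fun y => G.Adj x y).card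
    let X' := (V (u 0)).filter fun x => ¬ 2 * s ≤ ((V (u 1)).filter fun y => G.Adj x y).card
    have hXX : X.card + X'.card = (V (u 0)).card := card_filter_add_card_filter_not _
    have h1 : X'.card < s := by
      by_contra hge
      obtain ⟨x, hx, hx'⟩ := hdeg _ _ (huadj 0 (by omega)) X' (filter_subset _ _) (V (u 1))
        Subset.rfl (by omega) (by have := hVu 1; omega)
      exact (mem_filter.1 hx).2 hx'
    obtain ⟨x, hx, hx'⟩ := hdeg _ _ hlastadj X (filter_subset _ _) (V (u (L - 1)))
        Subset.rfl (by have := hVu 0; omega) (by have := hVu (L - 1); omega)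
    rw [mem_filter] at hx
    have := hcon x hx.1 hx.2
    omega
  -- `S` is a reserve of neighbours of `x₀` in the last cluster, kept free so that the cycle can be
  -- closed. The factor 2 in `2 * s` pays for removing it from the neighbours of `x₀`.
  obtain ⟨S, hSsub, hS⟩ := exists_subset_card_eq
    (show s ≤ ((V (u (L - 1))).filter fun y => G.Adj x₀ y).card by omega)
  have hSV : S ⊆ V (u (L - 1)) := hSsub.trans (filter_subset _ _)
  have hx₀S : x₀ ∉ S := fun hmem =>
    Finset.disjoint_left.1 (hdisj _ _ hlastadj.ne) hx₀ (hSV hmem)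
  -- the vertices of the cluster of index `i` that are still available
  let A : (ℕ → α) → ℕ → ℕ → Finset α := fun f k i => (V (u i) \ (range k).image f) \ S
  have hAcard : ∀ f : ℕ → α, ∀ k, k ≤ L → (∀ j < k, f j ∈ V (u j)) → ∀ i,
      h ≤ (A f k i).card := by
    intro f k hk hf i
    have h1 : V (u i) ⊆ A f k i ∪ (((range (L + 1)).filter fun j => u j = u i).image f ∪ S) := by
      intro x hx
      by_cases hxS : x ∈ S
      · simp [hxS]
      · by_cases hxf : x ∈ (range k).image f
        · obtain ⟨j, hj, rfl⟩ := mem_image.1 hxf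
          rw [mem_range] at hj
          have : u j = u i := by
            by_contra hne
            exact Finset.disjoint_left.1 (hdisj _ _ hne) (hf j hj) hx
          refine mem_union_right _ (mem_union_left _ (mem_image_of_mem _ ?_))
          simp only [mem_filter, mem_range]
          exact ⟨by omega, this⟩
        · exact mem_union_left _ (mem_sdiff.2 ⟨mem_sdiff.2 ⟨hx, hxf⟩, hxS⟩)
    have h2 := (card_le_card h1).trans (card_union_le _ _)
    have h3 := card_union_le (((range (L + 1)).filter fun j => u j = u i).image f) S
    have h4 : (((range (L + 1)).filter fun j => u j = u i).image f).card ≤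
        p.support.count (u i) := by
      rw [← card_filter_getVert_eq p (u i)]
      exact card_image_le
    have h5 := hcount _ (husupp i)
    omega
  -- Invariant of the greedy path: its last vertex still has `s` available neighbours in the next
  -- cluster. Among them `hdeg` finds a continuation with the same property.
  have key : ∀ k, k + 3 ≤ L → ∃ f : ℕ → α, f 0 = x₀ ∧ (∀ j ≤ k, f j ∈ V (u j)) ∧
      (∀ j ≤ k, f j ∉ S) ∧ (∀ i ≤ k, ∀ j ≤ k, f i = f j → i = j) ∧
      (∀ j < k, G.Adj (f j) (f (j + 1))) ∧
      s ≤ ((A f (k + 1) (k + 1)).filter fun y => G.Adj (f k) y).card := by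
    intro k
    induction k with
    | zero =>
      intro _
      refine ⟨fun _ => x₀, rfl, ?_, ?_, ?_, ?_, ?_⟩
      · intro j hj; rw [Nat.le_zero.1 hj]; exact hx₀
      · exact fun j _ => hx₀S
      · intro i hi j hj _; omega
      · intro j hj; omega
      · have h1 : ((V (u 1)).filter fun y => G.Adj x₀ y) ⊆
            ((A (fun _ => x₀) (0 + 1) (0 + 1)).filter fun y => G.Adj x₀ y) ∪ S := by
          intro y hy
          rw [mem_filter] at hy
          by_cases hyS : y ∈ S
          · exact mem_union_right _ hyS
          · refine mem_union_left _ (mem_filter.2 ⟨mem_sdiff.2 ⟨mem_sdiff.2 ⟨hy.1, ?_⟩, hyS⟩, hy.2⟩)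
            intro hmem
            obtain ⟨_, _, hxy⟩ := mem_image.1 hmem
            exact hy.2.ne hxy
        have h2 := (card_le_card h1).trans (card_union_le _ _)
        beta_reduce
        omega
    | succ k ih =>
      intro hk
      obtain ⟨f, hf0, hfV, hfS, hfinj, hfadj, hfs⟩ := ih (by omega)
      have hYc := hAcard f (k + 1) (by omega) (fun j hj => hfV j (by omega)) (k + 2)
      obtain ⟨x, hx, hxY⟩ := hdeg _ _ (huadj (k + 1) (by omega)) _
        ((filter_subset _ _).trans (sdiff_subset.trans sdiff_subset)) (A f (k + 1) (k + 2))
        (sdiff_subset.trans sdiff_subset) hfs hYc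
      rw [mem_filter, mem_sdiff, mem_sdiff] at hx
      obtain ⟨⟨⟨hxV, hxf⟩, hxS⟩, hxadj⟩ := hx
      let f' := Function.update f (k + 1) x
      have hf'x : f' (k + 1) = x := Function.update_self ..
      have hf' : ∀ j ≤ k, f' j = f j := fun j hj =>
        Function.update_of_ne (by omega) ..
      have hxf' : ∀ j ≤ k, f j ≠ x := fun j hj hjx =>
        hxf (mem_image.2 ⟨j, mem_range.2 (by omega), hjx⟩)
      refine ⟨f', by rw [hf' 0 (by omega), hf0], ?_, ?_, ?_, ?_, ?_⟩
      · intro j hj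
        rcases Nat.le_succ_iff.1 hj with hj | rfl
        · rw [hf' j hj]; exact hfV j hj
        · rw [hf'x]; exact hxV
      · intro j hj
        rcases Nat.le_succ_iff.1 hj with hj | rfl
        · rw [hf' j hj]; exact hfS j hj
        · rw [hf'x]; exact hxS
      · intro i hi j hj hij
        rcases Nat.le_succ_iff.1 hi with hi | rfl <;> rcases Nat.le_succ_iff.1 hj with hj | rfl
        · rw [hf' i hi, hf' j hj] at hij
          exact hfinj i hi j hj hij
        · rw [hf' i hi, hf'x] at hij
          exact absurd hij (hxf' i hi)
        · rw [hf' j hj, hf'x] at hij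
          exact absurd hij.symm (hxf' j hj)
        · rfl
      · intro j hj
        rcases Nat.lt_succ_iff_lt_or_eq.1 hj with hj | rfl
        · rw [hf' j (by omega), hf' (j + 1) (by omega)]; exact hfadj j hj
        · rw [hf' j le_rfl, hf'x]; exact hxadj
      · rw [hf'x]
        refine (by omega : s ≤ 2 * s).trans (hxY.trans (card_le_card (filter_subset_filter _ ?_)))
        intro y hy
        rw [mem_sdiff, mem_sdiff] at hy ⊢
        refine ⟨⟨hy.1.1, ?_⟩, hy.2⟩
        intro hmem
        obtain ⟨j, hj, hjy⟩ := mem_image.1 hmem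
        rw [mem_range] at hj
        rcases Nat.lt_succ_iff_lt_or_eq.1 hj with hj | rfl
        · rw [hf' j (by omega)] at hjy
          exact hy.1.2 (mem_image.2 ⟨j, mem_range.2 hj, hjy⟩)
        · rw [hf'x] at hjy
          subst hjy
          exact Finset.disjoint_left.1 (hdisj _ _ (huadj (k + 1) (by omega)).ne) hxV hy.1.1
  obtain ⟨f, hf0, hfV, hfS, hfinj, hfadj, hfs⟩ := key (L - 3) (by omega)
  have e2 : L - 3 + 1 = L - 2 := by omega
  have e1 : L - 2 + 1 = L - 1 := by omega
  rw [e2] at hfs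
  have hadj2 := huadj (L - 2) (by omega)
  rw [e1] at hadj2
  -- The last two vertices are chosen together: an edge from the available neighbours of `f (L - 3)`
  -- to the reserve `S`.
  obtain ⟨x, hx, y, hyS, hxy⟩ := hedge _ _ hadj2 _
    ((filter_subset _ _).trans (sdiff_subset.trans sdiff_subset)) S hSV hfs hS.ge
  rw [mem_filter, mem_sdiff, mem_sdiff] at hx
  obtain ⟨⟨⟨hxV, hxf⟩, hxS⟩, hxadj⟩ := hx
  have hxf' : ∀ j ≤ L - 3, f j ≠ x := fun j hj hjx =>
    hxf (mem_image.2 ⟨j, mem_range.2 (by omega), hjx⟩)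
  let F : ℕ → α := fun j => if j ≤ L - 3 then f j else if j = L - 2 then x else y
  have hF1 : ∀ j ≤ L - 3, F j = f j := fun j hj => if_pos hj
  have hF2 : F (L - 2) = x := by simp only [F]; rw [if_neg (by omega)]; simp
  have hF3 : F (L - 1) = y := by simp only [F]; rw [if_neg (by omega), if_neg (by omega)]
  have hcases : ∀ j < L, j ≤ L - 3 ∨ j = L - 2 ∨ j = L - 1 := fun j hj => by omega
  have hfy : ∀ j ≤ L - 3, f j ≠ y := fun j hj hjy => hfS j hj (hjy ▸ hyS)
  refine cycleGraph_isContained_of_seq F ?_ ?_ ?_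
  · intro i hi j hj hij
    rcases hcases i hi with hi | rfl | rfl <;> rcases hcases j hj with hj | rfl | rfl
    · rw [hF1 i hi, hF1 j hj] at hij
      exact hfinj i hi j hj hij
    · rw [hF1 i hi, hF2] at hij
      exact absurd hij (hxf' i hi)
    · rw [hF1 i hi, hF3] at hij
      exact absurd hij (hfy i hi)
    · rw [hF1 j hj, hF2] at hij
      exact absurd hij.symm (hxf' j hj)
    · rfl
    · rw [hF2, hF3] at hij
      exact absurd hij hxy.ne
    · rw [hF1 j hj, hF3] at hij
      exact absurd hij.symm (hfy j hj)
    · rw [hF2, hF3] at hij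
      exact absurd hij hxy.ne'
    · rfl
  · intro i hi
    rcases (by omega : i < L - 3 ∨ i = L - 3 ∨ i = L - 2) with hi | rfl | rfl
    · rw [hF1 i hi.le, hF1 (i + 1) hi]
      exact hfadj i hi
    · rw [hF1 _ le_rfl, e2, hF2]
      exact hxadj
    · rw [hF2, e1, hF3]
      exact hxy
  · intro _
    rw [hF3, hF1 0 (by omega), hf0]
    exact (mem_filter.1 (hSsub hyS)).2.symm

/-! ### Regular pairs and the cluster graph. -/

section Regularity

variable {α : Type*} {G : SimpleGraph α} [DecidableRel G.Adj]

theorem card_interedges_eq_sum (X Y : Finset α) :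
    (G.interedges X Y).card = ∑ x ∈ X, (Y.filter fun y => G.Adj x y).card := by
  rw [interedges_def, card_filter, sum_product]
  simp_rw [card_filter]

theorem card_interedges_eq_edgeDensity_mul (X Y : Finset α) :
    ((G.interedges X Y).card : ℝ) = (G.edgeDensity X Y : ℝ) * (X.card * Y.card) := by
  rcases X.eq_empty_or_nonempty with rfl | hX
  · simp
  rcases Y.eq_empty_or_nonempty with rfl | hY
  · simp [interedges_def]
  have h1 : (X.card : ℝ) ≠ 0 := by simpa using hX.ne_empty
  have h2 : (Y.card : ℝ) ≠ 0 := by simpa using hY.ne_empty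
  rw [edgeDensity_def]
  push_cast
  field_simp

theorem exists_degree_ge_of_edgeDensity {X Y : Finset α} (hX : X.Nonempty) {c : ℝ}
    (h : c ≤ (G.edgeDensity X Y : ℝ)) :
    ∃ x ∈ X, c * Y.card ≤ ((Y.filter fun y => G.Adj x y).card : ℝ) := by
  by_contra hcon
  push Not at hcon
  have h1 := card_interedges_eq_edgeDensity_mul (G := G) X Y
  rw [card_interedges_eq_sum, Nat.cast_sum] at h1
  have h2 := sum_lt_sum_of_nonempty hX hcon
  rw [h1, sum_const, nsmul_eq_mul] at h2
  have h3 : c * (X.card * Y.card : ℝ) ≤ (G.edgeDensity X Y : ℝ) * (X.card * Y.card) := by gcongr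
  linarith

/-- Uniformity passes the density on to `X` and `Y` up to `ε`, and some vertex of `X` attains the
average degree. -/
theorem IsUniform.exists_degree_ge {U V X Y : Finset α} {ε d : ℝ} (hU : G.IsUniform ε U V)
    (hd : d ≤ (G.edgeDensity U V : ℝ)) (hXU : X ⊆ U) (hYV : Y ⊆ V) (hX0 : X.Nonempty)
    (hX : U.card * ε ≤ X.card) (hY : V.card * ε ≤ Y.card) :
    ∃ x ∈ X, (d - ε) * Y.card ≤ ((Y.filter fun y => G.Adj x y).card : ℝ) := by
  refine exists_degree_ge_of_edgeDensity hX0 ?_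
  have := (abs_lt.1 (hU hXU hYV hX hY)).1
  linarith

variable [DecidableEq α]

/-- A cluster graph containing a set `W` of at least `2 * t` clusters in one component, each with
at least `t` neighbours in `W`, yields a cycle of length `2 * m`. -/
theorem cycleGraph_isContained_of_cluster_component {ι : Type*} [DecidableEq ι] [Fintype ι]
    {R : SimpleGraph ι} [DecidableRel R.Adj] (V : ι → Finset α)
    (hdisj : ∀ a b, a ≠ b → Disjoint (V a) (V b)) {s h : ℕ} (hs : 0 < s)
    (hedge : ∀ a b, R.Adj a b → ∀ X ⊆ V a, ∀ Y ⊆ V b, s ≤ X.card → s ≤ Y.card →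
      ∃ x ∈ X, ∃ y ∈ Y, G.Adj x y)
    (hdeg : ∀ a b, R.Adj a b → ∀ X ⊆ V a, ∀ Y ⊆ V b, s ≤ X.card → h ≤ Y.card →
      ∃ x ∈ X, 2 * s ≤ (Y.filter fun y => G.Adj x y).card)
    {o : ι} (W : Finset ι) (hW : ∀ a ∈ W, R.Reachable o a) {t m cap : ℕ} (hm : 2 ≤ m)
    (ht : 2 * t ≤ W.card) (htdeg : ∀ a ∈ W, t ≤ (W.filter fun b => R.Adj a b).card)
    (hcap : m ≤ t * cap) (htm : t * Fintype.card ι ≤ m)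
    (hsize : ∀ a, 2 * (t * Fintype.card ι) + cap + 1 + 2 * s + h ≤ (V a).card) :
    (cycleGraph (2 * m)).IsContained G := by
  obtain ⟨g, hg⟩ := hasMatching_of_minDegree W t ht htdeg
  obtain ⟨Q, hQ, hwalk⟩ := exists_closed_walk o g hg.inj hg.adj (fun i => hW _ (hg.mem _)) cap univ
  rw [card_univ, Fintype.card_fin] at hQ hwalk
  -- With `m - Q` round trips the total length `2 * ((m - Q) + Q)` is exactly `2 * m`.
  obtain ⟨p, hp, hc⟩ := hwalk (m - Q) (by omega)
  have hp' : p.length = 2 * m := by omega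
  rw [← hp']
  refine cycleGraph_isContained_of_closed_walk V hdisj hs hedge hdeg p (by omega) fun a _ => ?_
  have h1 := hc a
  have h2 := hsize a
  have h3 : p.support.count a ≤ p.support.tail.count a + 1 := by
    rw [← Walk.cons_tail_support p, List.count_cons, List.tail_cons]
    split_ifs <;> omega
  split_ifs at h1 <;> omega

variable [Fintype α] (P : Finpartition (univ : Finset α)) (G)

open Classical in
/-- The parts that form a non-uniform pair with at most `θ * k` of the `k` parts. -/
noncomputable def goodParts (ε θ : ℝ) : Finset P.parts :=
  univ.filter fun a => ((univ.filter fun b : P.parts =>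
    a ≠ b ∧ ¬ G.IsUniform ε a.1 b.1).card : ℝ) ≤ θ * P.parts.card

/-- The cluster graph: good parts are adjacent if they form a uniform pair of density at least
`d`. -/
def clusterGraph (ε θ d : ℝ) : SimpleGraph P.parts where
  Adj a b := a ≠ b ∧ a ∈ goodParts G P ε θ ∧ b ∈ goodParts G P ε θ ∧
    G.IsUniform ε a.1 b.1 ∧ d ≤ (G.edgeDensity a.1 b.1 : ℝ)
  symm := ⟨fun a b h => ⟨h.1.symm, h.2.2.1, h.2.1, h.2.2.2.1.symm, by
    rw [edgeDensity_comm]; exact h.2.2.2.2⟩⟩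
  loopless := ⟨fun _ h => h.1 rfl⟩

variable {G P} {ε θ d : ℝ}

/-- Double counting: a bad part lies in more than `θ * k` irregular ordered pairs, and there are at
most `θ ^ 2 * k ^ 2` of these for `k` parts. This is the reason for `ε = θ ^ 2`. -/
theorem card_bad_parts_le (hθ : 0 < θ) (hε : ε = θ ^ 2) (hP : P.IsUniform G ε) :
    (((goodParts G P ε θ)ᶜ).card : ℝ) ≤ θ * P.parts.card := by
  classical
  rcases Nat.eq_zero_or_pos P.parts.card with hk | hk
  · have : (goodParts G P ε θ)ᶜ.card ≤ P.parts.card := by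
      simpa using card_le_univ (goodParts G P ε θ)ᶜ
    rw [hk] at this ⊢
    simp [Nat.le_zero.1 this]
  have hk' : (0 : ℝ) < P.parts.card := by exact_mod_cast hk
  have h1 : ∑ a : P.parts, (univ.filter fun b : P.parts =>
      a ≠ b ∧ ¬ G.IsUniform ε a.1 b.1).card ≤ (P.nonUniforms G ε).card := by
    rw [← card_sigma]
    refine card_le_card_of_injOn (fun x => (x.1.1, x.2.1)) ?_ ?_
    · rintro ⟨a, b⟩ hx
      simp only [coe_sigma, Set.mem_sigma_iff, coe_univ, Set.mem_univ, true_and, coe_filter,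
        mem_univ, Set.mem_ofPred_eq] at hx
      rw [mem_coe, Finpartition.mk_mem_nonUniforms]
      exact ⟨a.2, b.2, fun h => hx.1 (Subtype.ext h), hx.2⟩
    · rintro ⟨a, b⟩ - ⟨a', b'⟩ - h
      simp only [Prod.mk.injEq] at h
      obtain ⟨h1, h2⟩ := h
      obtain rfl := Subtype.ext h1
      obtain rfl := Subtype.ext h2
      rfl
  have h2 : ∑ _a ∈ (goodParts G P ε θ)ᶜ, θ * (P.parts.card : ℝ) ≤
      ∑ a : P.parts, ((univ.filter fun b : P.parts =>
      a ≠ b ∧ ¬ G.IsUniform ε a.1 b.1).card : ℝ) := by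
    refine (sum_le_sum fun a ha => ?_).trans
      (sum_le_sum_of_subset_of_nonneg (subset_univ (goodParts G P ε θ)ᶜ) fun _ _ _ => by positivity)
    rw [mem_compl, goodParts, mem_filter] at ha
    simp only [mem_univ, true_and, not_le] at ha
    convert! ha.le
  have h3 : ((P.nonUniforms G ε).card : ℝ) ≤ (P.parts.card : ℝ) * P.parts.card * θ ^ 2 := by
    refine (hP : _ ≤ _).trans ?_
    rw [hε]
    gcongr
    rw [← Nat.cast_mul]
    exact_mod_cast Nat.mul_le_mul_left _ (Nat.sub_le _ _)
  rw [sum_const, nsmul_eq_mul] at h2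
  have h4 : (((goodParts G P ε θ)ᶜ).card : ℝ) * (θ * P.parts.card) ≤
      (θ * P.parts.card) * (θ * P.parts.card) := by
    have h1' : ((∑ a : P.parts, (univ.filter fun b : P.parts =>
      a ≠ b ∧ ¬ G.IsUniform ε a.1 b.1).card : ℕ) : ℝ) ≤ (P.nonUniforms G ε).card := by
      exact_mod_cast h1
    push_cast at h1'
    calc _ ≤ _ := h2
      _ ≤ _ := h1'
      _ ≤ _ := h3
      _ = _ := by ring
  exact le_of_mul_le_mul_right h4 (by positivity)

theorem sum_card_parts_coe : ∑ b : P.parts, b.1.card = Fintype.card α := by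
  rw [sum_coe_sort P.parts card, P.sum_card_parts, card_univ]

theorem degree_eq_sum_parts (x : α) :
    G.degree x = ∑ b : P.parts, (b.1.filter fun y => G.Adj x y).card := by
  classical
  rw [sum_coe_sort P.parts (fun b => (b.filter fun y => G.Adj x y).card),
    ← card_neighborFinset_eq_degree, ← card_biUnion]
  · congr 1
    ext y
    simp only [mem_neighborFinset, mem_biUnion, mem_filter]
    refine ⟨fun h => ⟨P.part y, by simp, by simp, h⟩, fun ⟨_, _, _, h⟩ => h⟩
  · intro a ha b hb hab
    exact (P.disjoint ha hb hab).mono (filter_subset _ _) (filter_subset _ _)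

open Classical in
/-- The minimum degree is inherited by the cluster graph, up to a small error. -/
theorem clusterGraph_degree_ge (hθ : 0 < θ) (hd : 0 ≤ d) (hε : ε = θ ^ 2) (hP : P.IsUniform G ε)
    {w D : ℝ} (hw : ∀ b ∈ P.parts, (b.card : ℝ) ≤ w) (hD : ∀ x, D ≤ (G.degree x : ℝ))
    {a : P.parts} (ha : a ∈ goodParts G P ε θ) :
    D ≤ w + 2 * θ * P.parts.card * w + d * Fintype.card α +
      (univ.filter fun b => (clusterGraph G P ε θ d).Adj a b).card * w := by
  have hw0 : 0 ≤ w := (Nat.cast_nonneg _).trans (hw a.1 a.2)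
  have hapos : (0 : ℝ) < a.1.card := by
    exact_mod_cast (P.nonempty_of_mem_parts a.2).card_pos
  have h1 : (a.1.card : ℝ) * D ≤ ∑ b : P.parts, ((G.interedges a.1 b.1).card : ℝ) := by
    calc (a.1.card : ℝ) * D = ∑ _x ∈ a.1, D := by rw [sum_const, nsmul_eq_mul]
      _ ≤ ∑ x ∈ a.1, (G.degree x : ℝ) := sum_le_sum fun x _ => hD x
      _ = ∑ x ∈ a.1, ∑ b : P.parts, ((b.1.filter fun y => G.Adj x y).card : ℝ) := by
          refine sum_congr rfl fun x _ => ?_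
          rw [degree_eq_sum_parts (P := P) x]
          push_cast
          rfl
      _ = _ := by
          rw [sum_comm]
          refine sum_congr rfl fun b _ => ?_
          rw [card_interedges_eq_sum]
          push_cast
          rfl
  -- The five terms cover the possible reasons for edges from `a` to `b`: same part, bad part,
  -- irregular pair, sparse pair, cluster edge.
  have h2 : ∀ b : P.parts, ((G.interedges a.1 b.1).card : ℝ) ≤ a.1.card *
      ((if a = b then w else 0) + (if b ∈ (goodParts G P ε θ)ᶜ then w else 0) +
        (if a ≠ b ∧ ¬ G.IsUniform ε a.1 b.1 then w else 0) + d * b.1.card +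
        (if (clusterGraph G P ε θ d).Adj a b then w else 0)) := by
    intro b
    have hle : ((G.interedges a.1 b.1).card : ℝ) ≤ a.1.card * w := by
      calc ((G.interedges a.1 b.1).card : ℝ) ≤ a.1.card * b.1.card := by
            exact_mod_cast G.card_interedges_le_mul a.1 b.1
        _ ≤ _ := by gcongr; exact hw b.1 b.2
    have i1 : 0 ≤ (if a = b then w else 0) := by split_ifs <;> simp [hw0]
    have i2 : 0 ≤ (if b ∈ (goodParts G P ε θ)ᶜ then w else 0) := by split_ifs <;> simp [hw0]
    have i3 : 0 ≤ (if a ≠ b ∧ ¬ G.IsUniform ε a.1 b.1 then w else 0) := by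
      split_ifs <;> simp [hw0]
    have i4 : 0 ≤ d * (b.1.card : ℝ) := by positivity
    have i5 : 0 ≤ (if (clusterGraph G P ε θ d).Adj a b then w else 0) := by
      split_ifs <;> simp [hw0]
    by_cases c1 : a = b
    · rw [if_pos c1] at i1 ⊢
      exact hle.trans (by gcongr; linarith)
    by_cases c2 : b ∈ (goodParts G P ε θ)ᶜ
    · rw [if_pos c2] at i2 ⊢
      exact hle.trans (by gcongr; linarith)
    by_cases c3 : a ≠ b ∧ ¬ G.IsUniform ε a.1 b.1
    · rw [if_pos c3] at i3 ⊢
      exact hle.trans (by gcongr; linarith)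
    by_cases c4 : (clusterGraph G P ε θ d).Adj a b
    · rw [if_pos c4] at i5 ⊢
      exact hle.trans (by gcongr; linarith)
    have c5 : (G.edgeDensity a.1 b.1 : ℝ) ≤ d := by
      by_contra hlt
      refine c4 ⟨c1, ha, by simpa using c2, ?_, (not_le.1 hlt).le⟩
      by_contra hu
      exact c3 ⟨c1, hu⟩
    calc ((G.interedges a.1 b.1).card : ℝ)
        = (G.edgeDensity a.1 b.1 : ℝ) * (a.1.card * b.1.card) :=
          card_interedges_eq_edgeDensity_mul _ _
      _ ≤ d * (a.1.card * b.1.card) := by gcongr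
      _ = a.1.card * (d * b.1.card) := by ring
      _ ≤ _ := by gcongr; linarith
  have h3 := h1.trans (sum_le_sum fun b _ => h2 b)
  rw [← mul_sum] at h3
  have h4 := le_of_mul_le_mul_left h3 hapos
  simp only [sum_add_distrib, ← mul_sum] at h4
  have e1 : ∑ b : P.parts, (if a = b then w else 0) = w := by simp
  have e2 : ∑ b : P.parts, (if b ∈ (goodParts G P ε θ)ᶜ then w else 0) ≤
      θ * P.parts.card * w := by
    rw [← sum_filter, sum_const, nsmul_eq_mul]
    gcongr
    refine le_trans ?_ (card_bad_parts_le hθ hε hP)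
    rw [filter_mem_eq_inter, univ_inter]
  have e3 : ∑ b : P.parts, (if a ≠ b ∧ ¬ G.IsUniform ε a.1 b.1 then w else 0) ≤
      θ * P.parts.card * w := by
    rw [← sum_filter, sum_const, nsmul_eq_mul]
    gcongr
    exact (mem_filter.1 ha).2
  have e4 : ∑ b : P.parts, (b.1.card : ℝ) = Fintype.card α := by
    exact_mod_cast sum_card_parts_coe (P := P)
  have e5 : ∑ b : P.parts, (if (clusterGraph G P ε θ d).Adj a b then w else 0) =
      (univ.filter fun b => (clusterGraph G P ε θ d).Adj a b).card * w := by
    rw [← sum_filter, sum_const, nsmul_eq_mul]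
  rw [e1, e4, e5] at h4
  linarith

open Classical in
/-- Few edges of `G` run between good parts that are distinct and not adjacent in the cluster
graph. -/
theorem card_edges_outside_clusterGraph_le (hd : 0 ≤ d) (hε : 0 < ε) (hP : P.IsUniform G ε)
    (hPe : P.IsEquipartition) (S : Finset (α × α))
    (hS : ∀ x ∈ S, G.Adj x.1 x.2 ∧ ∃ a b : P.parts, a ≠ b ∧ a ∈ goodParts G P ε θ ∧
      b ∈ goodParts G P ε θ ∧ x.1 ∈ a.1 ∧ x.2 ∈ b.1 ∧ ¬ (clusterGraph G P ε θ d).Adj a b) :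
    (S.card : ℝ) ≤ 4 * (ε + d) * (Fintype.card α : ℝ) ^ 2 := by
  rcases S.eq_empty_or_nonempty with rfl | ⟨x₀, hx₀⟩
  · simp only [card_empty, Nat.cast_zero]
    positivity
  have hne : (univ : Finset α).Nonempty := ⟨x₀.1, mem_univ _⟩
  have h1 := hPe.sum_nonUniforms_lt hne hε hP
  have h2 := hPe.card_interedges_sparsePairs_le (G := G) hd
  have h3 : S ⊆ ((P.nonUniforms G ε).biUnion fun (U, V) => U ×ˢ V) ∪
      ((P.sparsePairs G d).biUnion fun (U, V) => G.interedges U V) := by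
    intro x hx
    obtain ⟨hadj, a, b, hab, ha, hb, hxa, hxb, hR⟩ := hS x hx
    have hab' : a.1 ≠ b.1 := fun h => hab (Subtype.ext h)
    by_cases hu : G.IsUniform ε a.1 b.1
    · refine mem_union_right _ (mem_biUnion.2 ⟨(a.1, b.1), ?_, ?_⟩)
      · rw [Finpartition.mk_mem_sparsePairs]
        refine ⟨a.2, b.2, hab', ?_⟩
        by_contra hlt
        exact hR ⟨hab, ha, hb, hu, not_lt.1 hlt⟩
      · exact (mem_interedges_iff G).2 ⟨hxa, hxb, hadj⟩
    · refine mem_union_left _ (mem_biUnion.2 ⟨(a.1, b.1), ?_, ?_⟩)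
      · rw [Finpartition.mk_mem_nonUniforms]
        exact ⟨a.2, b.2, hab', hu⟩
      · exact mem_product.2 ⟨hxa, hxb⟩
  have h4 : (S.card : ℝ) ≤ (((P.nonUniforms G ε).biUnion fun (U, V) => U ×ˢ V).card : ℝ) +
      (((P.sparsePairs G d).biUnion fun (U, V) => G.interedges U V).card : ℝ) := by
    exact_mod_cast (card_le_card h3).trans (card_union_le _ _)
  rw [card_univ] at h1 h2
  linarith

end Regularity

/-! ### Splitting a graph without a cycle of length `2 * m`. -/

/-- The numerical inequalities linking cluster sizes (`w` or `w + 1`), the number `k` of clusters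
and the half-length `m` of the cycle. -/
theorem cluster_arithmetic {ε d θ m N k w K : ℝ} (hε : 0 < ε) (hε1 : ε ≤ 1) (hd : 0 < d)
    (hdε : d ≤ ε / 1000) (hθ : θ = ε * d / 1000) (hm : 0 < m) (hN : N ≤ 10 * m)
    (hk : 1000 / ε ≤ k) (hkw : k * w ≤ N) (hw1 : 10 / ε ≤ w)
    (hw2 : 100 / (d * ε) ≤ w) (hw3 : 10 * (2 * K ^ 2 + 6) / ε ≤ w) :
    w + 1 ≤ ε * m / 50 ∧ k * (w + 1) ≤ 20 * m ∧
      (w + 1) + 2 * θ * k * (w + 1) + d * N ≤ ε * m / 10 ∧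
      1 / (w + 1) ≤ ε / 10 ∧
      θ ^ 2 ≤ d / 2 ∧ 2 * (θ ^ 2 * (w + 1) + 1) ≤ (d - θ ^ 2) * (ε / 20 * (w + 1)) ∧
      θ ^ 2 ≤ ε / 40 ∧
      2 * K ^ 2 + ((1 - ε / 4) * (w + 1) + 1) + 1 + 2 * (θ ^ 2 * (w + 1) + 1) +
        (ε / 20 * (w + 1) + 1) ≤ w := by
  have hk0 : 0 < k := lt_of_lt_of_le (by positivity) hk
  have hw0 : 10 ≤ w := le_trans (by rw [le_div_iff₀ hε]; linarith) hw1
  have hk' : 1000 ≤ k * ε := by rwa [div_le_iff₀ hε] at hk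
  have hw1' : 10 ≤ w * ε := by rwa [div_le_iff₀ hε] at hw1
  have hw2' : 100 ≤ w * (d * ε) := by rwa [div_le_iff₀ (by positivity)] at hw2
  have hw3' : 10 * (2 * K ^ 2 + 6) ≤ w * ε := by rwa [div_le_iff₀ hε] at hw3
  have hkw1 : k * (w + 1) ≤ 20 * m := by nlinarith
  have hθ0 : 0 < θ := by rw [hθ]; positivity
  have hd1 : d ≤ 1 := by linarith
  have hed : ε * d ≤ d := by nlinarith
  have hed0 : 0 < ε * d := by positivity
  have hθle : θ ≤ ε * d / 1000 := hθ.le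
  have hθ1 : θ ≤ 1 / 1000 := by linarith
  have hθ2 : θ ^ 2 ≤ ε * d / 1000 := by nlinarith
  have hede : ε * d ≤ ε := by nlinarith
  have h1 : w + 1 ≤ ε * m / 50 := by
    have : 1000 * (w + 1) ≤ ε * (20 * m) := by
      calc 1000 * (w + 1) ≤ k * ε * (w + 1) := by gcongr
        _ = ε * (k * (w + 1)) := by ring
        _ ≤ _ := by gcongr
    linarith
  refine ⟨h1, hkw1, ?_, ?_, by linarith, ?_, by linarith, ?_⟩
  · have a1 : 2 * θ * k * (w + 1) ≤ 40 * θ * m := by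
      calc 2 * θ * k * (w + 1) = 2 * θ * (k * (w + 1)) := by ring
        _ ≤ 2 * θ * (20 * m) := by gcongr
        _ = _ := by ring
    have a2 : 40 * θ * m ≤ 40 * (ε / 1000) * m := by gcongr; linarith
    have a3 : d * N ≤ (ε / 1000) * (10 * m) := by
      calc d * N ≤ d * (10 * m) := by gcongr
        _ ≤ _ := by gcongr
    nlinarith
  · rw [div_le_iff₀ (by linarith)]
    nlinarith
  · have b1 : θ ^ 2 * (w + 1) ≤ ε * d / 1000 * (w + 1) := by gcongr
    have b2 : d / 2 * (ε / 20 * (w + 1)) ≤ (d - θ ^ 2) * (ε / 20 * (w + 1)) := by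
      gcongr; linarith
    nlinarith
  · have b1 : θ ^ 2 * (w + 1) ≤ ε / 1000 * (w + 1) := by gcongr; linarith
    nlinarith

set_option maxHeartbeats 1600000 in
/-- A graph of minimum degree at least `(1 + ε) m` on at most `10 m` vertices without a cycle of
length `2 m` splits, up to few vertices and edges, into parts of size between `(1 + ε / 2) m` and
`2 (1 + ε) m` with no edges between them. -/
theorem exists_sparse_partition {ε γ : ℝ} (hε : 0 < ε) (hε1 : ε ≤ 1) (hγ : 0 < γ) (hγ1 : γ ≤ 1) :
    ∃ m₀ : ℕ, ∀ m ≥ m₀, ∀ (α : Type) [Fintype α] [DecidableEq α] (G : SimpleGraph α)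
      [DecidableRel G.Adj], Fintype.card α ≤ 10 * m →
      (∀ x, (1 + ε) * m ≤ (G.degree x : ℝ)) → ¬ (cycleGraph (2 * m)).IsContained G →
      ∃ (E : Finset α) (f : α → ℕ), (E.card : ℝ) ≤ γ * m ∧
        (((univ : Finset (α × α)).filter fun x => x.1 ∉ E ∧ x.2 ∉ E ∧ f x.1 ≠ f x.2 ∧
          G.Adj x.1 x.2).card : ℝ) ≤ γ * m ^ 2 ∧
        ∀ x ∉ E, (1 + ε / 2) * m ≤ ((univ.filter fun y => y ∉ E ∧ f y = f x).card : ℝ) ∧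
          ((univ.filter fun y => y ∉ E ∧ f y = f x).card : ℝ) ≤ 2 * (1 + ε) * m := by
  classical
  set d : ℝ := ε * γ / 1000 with hd
  have hd0 : 0 < d := by positivity
  set θ : ℝ := ε * d / 1000 with hθ
  have hθ0 : 0 < θ := by positivity
  set ε₀ : ℝ := θ ^ 2 with hε₀
  have hε₀0 : 0 < ε₀ := by positivity
  have hdε : d ≤ ε / 1000 := by rw [hd]; nlinarith
  have hdγ : d ≤ γ / 1000 := by rw [hd]; nlinarith
  set l : ℕ := ⌈1000 / ε⌉₊ with hl
  set K : ℕ := SzemerediRegularity.bound ε₀ l with hK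
  obtain ⟨Z, hZ⟩ : ∃ Z : ℕ, 10 / ε ≤ Z ∧ 100 / (d * ε) ≤ Z ∧
      10 * (2 * (K : ℝ) ^ 2 + 6) / ε ≤ Z := by
    obtain ⟨Z, hZ⟩ := exists_nat_ge (max (10 / ε) (max (100 / (d * ε))
      (10 * (2 * (K : ℝ) ^ 2 + 6) / ε)))
    exact ⟨Z, (le_max_left _ _).trans hZ, ((le_max_left _ _).trans (le_max_right _ _)).trans hZ,
      ((le_max_right _ _).trans (le_max_right _ _)).trans hZ⟩
  -- There are at most `K` parts, so `K * (Z + 1)` makes every part have at least `Z` vertices; `K ^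
  -- 2` dominates the connecting paths of the closed walk; `l` is required by the regularity lemma.
  refine ⟨K * (Z + 1) + K ^ 2 + l + 2, ?_⟩
  intro m hm α _ _ G _ hN hdeg hC
  have hm0 : (0 : ℝ) < m := by
    have : 0 < m := by omega
    exact_mod_cast this
  -- the case of an empty vertex type is trivial
  rcases isEmpty_or_nonempty α with hα | ⟨⟨x₀⟩⟩
  · refine ⟨∅, fun _ => 0, ?_, ?_, fun x => hα.elim x⟩
    · simp only [card_empty, Nat.cast_zero]; positivity
    · simp only [univ_eq_empty, filter_empty, card_empty, Nat.cast_zero]; positivity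
  have hmN : m ≤ Fintype.card α := by
    have h1 := hdeg x₀
    have h2 : G.degree x₀ < Fintype.card α := G.degree_lt_card_verts x₀
    have h3 : (m : ℝ) ≤ G.degree x₀ := by nlinarith
    have h4 : m ≤ G.degree x₀ := by exact_mod_cast h3
    omega
  obtain ⟨P, hPe, hlk, hkK, hPu⟩ := szemeredi_regularity G hε₀0 (show l ≤ Fintype.card α by omega)
  set N := Fintype.card α with hNdef
  set k := P.parts.card with hkdef
  have hk0 : 0 < k := by
    have : 0 < l := Nat.ceil_pos.2 (by positivity)
    omega
  set w := N / k with hw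
  have hwlow : ∀ b ∈ P.parts, w ≤ b.card := fun b hb => by
    simpa using hPe.average_le_card_part hb
  have hwhigh : ∀ b ∈ P.parts, b.card ≤ w + 1 := fun b hb => by
    simpa using hPe.card_part_le_average_add_one hb
  have hkw : k * w ≤ N := Nat.mul_div_le N k
  have hZw : Z ≤ w := by
    rw [hw, Nat.le_div_iff_mul_le hk0]
    have : Z * k ≤ (Z + 1) * K := Nat.mul_le_mul (by omega) hkK
    rw [mul_comm (Z + 1)] at this
    omega
  have hZw' : (Z : ℝ) ≤ w := by exact_mod_cast hZw
  have hkl : 1000 / ε ≤ k := (Nat.le_ceil _).trans (by exact_mod_cast hlk)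
  obtain ⟨a1, a2, a3, a4, a5, a6, a7, a8⟩ := cluster_arithmetic (m := m) (N := N) (k := k)
    (w := w) (K := K) hε hε1 hd0 hdε hθ hm0 (by exact_mod_cast hN) hkl
    (by exact_mod_cast hkw) (hZ.1.trans hZw') (hZ.2.1.trans hZw') (hZ.2.2.trans hZw')
  have hw1 : (0 : ℝ) < w + 1 := by positivity
  set R := clusterGraph G P ε₀ θ d with hR
  set D := goodParts G P ε₀ θ with hD
  have hRdeg : ∀ a ∈ D, (1 + 0.9 * ε) * m ≤
      ((univ.filter fun b => R.Adj a b).card : ℝ) * (w + 1) := by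
    intro a ha
    have := clusterGraph_degree_ge (w := w + 1) (d := d) hθ0 hd0.le hε₀ hPu
      (fun b hb => by exact_mod_cast hwhigh b hb) hdeg ha
    linarith
  set t : ℕ := ⌈(1 + ε / 2) * m / (w + 1)⌉₊ with ht
  have ht1 : (1 + ε / 2) * m ≤ t * (w + 1) := by
    rw [← div_le_iff₀ hw1]; exact Nat.le_ceil _
  have ht2 : t * ((w : ℝ) + 1) ≤ (1 + 0.52 * ε) * m := by
    have h1 : (t : ℝ) < (1 + ε / 2) * m / (w + 1) + 1 := Nat.ceil_lt_add_one (by positivity)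
    have h2 : t * ((w : ℝ) + 1) ≤ ((1 + ε / 2) * m / (w + 1) + 1) * (w + 1) := by gcongr
    rw [add_mul, div_mul_cancel₀ _ hw1.ne'] at h2
    linarith
  have hεm : 0 < ε * m := by positivity
  have htdeg : ∀ a ∈ D, t ≤ (univ.filter fun b => R.Adj a b).card := by
    intro a ha
    have h1 := hRdeg a ha
    have h2 : (t : ℝ) * (w + 1) ≤ ((univ.filter fun b => R.Adj a b).card : ℝ) * (w + 1) := by
      linarith
    exact_mod_cast le_of_mul_le_mul_right h2 hw1
  -- the component of a good part
  let S : P.parts → Finset P.parts := fun a => D.filter fun b => R.Reachable a b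
  have hnbr : ∀ a, ∀ b ∈ S a, (univ.filter fun c => R.Adj b c) ⊆ S a := by
    intro a b hb c hc
    rw [mem_filter] at hb hc
    exact mem_filter.2 ⟨hc.2.2.2.1, hb.2.trans hc.2.reachable⟩
  -- A component with `2 * t` good parts has a matching of `t` cluster edges. Filling each part to a
  -- proportion `1 - ε / 4` suffices for length `2 * m`, as `(1 + ε / 2) * (1 - ε / 4) ≥ 1`; the
  -- remainder of the part absorbs the connecting paths and the embedding's slack.
  have hSsmall : ∀ a ∈ D, (S a).card < 2 * t := by
    intro a _
    by_contra hge
    refine hC ?_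
    set s : ℕ := ⌈θ ^ 2 * ((w : ℝ) + 1)⌉₊ with hs
    set h : ℕ := ⌈ε / 20 * ((w : ℝ) + 1)⌉₊ with hh
    set cap : ℕ := ⌈(1 - ε / 4) * ((w : ℝ) + 1)⌉₊ with hcap
    have s1 : θ ^ 2 * ((w : ℝ) + 1) ≤ s := Nat.le_ceil _
    have s2 : (s : ℝ) < θ ^ 2 * ((w : ℝ) + 1) + 1 := Nat.ceil_lt_add_one (by positivity)
    have h1 : ε / 20 * ((w : ℝ) + 1) ≤ h := Nat.le_ceil _
    have h2 : (h : ℝ) < ε / 20 * ((w : ℝ) + 1) + 1 := Nat.ceil_lt_add_one (by positivity)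
    have c1 : (1 - ε / 4) * ((w : ℝ) + 1) ≤ cap := Nat.le_ceil _
    have c0 : 0 ≤ (1 - ε / 4) * ((w : ℝ) + 1) := mul_nonneg (by linarith) hw1.le
    have c2 : (cap : ℝ) < (1 - ε / 4) * ((w : ℝ) + 1) + 1 := Nat.ceil_lt_add_one c0
    have hs0 : 0 < s := Nat.ceil_pos.2 (by positivity)
    have hpart : ∀ (U X : Finset α) (r : ℕ), U ∈ P.parts → r ≤ X.card →
        θ ^ 2 * ((w : ℝ) + 1) ≤ r → (U.card : ℝ) * ε₀ ≤ X.card := by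
      intro U X r hU hX hr
      have e1 : (U.card : ℝ) ≤ w + 1 := by exact_mod_cast hwhigh U hU
      have e2 : (r : ℝ) ≤ X.card := by exact_mod_cast hX
      calc (U.card : ℝ) * ε₀ ≤ (w + 1) * ε₀ := by gcongr
        _ = θ ^ 2 * ((w : ℝ) + 1) := by rw [hε₀]; ring
        _ ≤ _ := hr.trans e2
    have hdθ : 0 < d - ε₀ := by linarith
    have htk : t * Fintype.card P.parts ≤ k ^ 2 := by
      have e1 : 2 * t ≤ k := (not_lt.1 hge).trans (by simpa using card_le_univ (S a))
      rw [Fintype.card_coe, sq]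
      exact Nat.mul_le_mul_right _ (by omega)
    have hkK2 : k ^ 2 ≤ K ^ 2 := Nat.pow_le_pow_left hkK 2
    refine cycleGraph_isContained_of_cluster_component (R := R) (fun b : P.parts => b.1)
      (fun b c hbc => P.disjoint b.2 c.2 fun h => hbc (Subtype.ext h)) (s := s) (h := h) hs0
      ?_ ?_ (o := a) (S a) (fun b hb => (mem_filter.1 hb).2) (t := t) (cap := cap) (by omega)
      (not_lt.1 hge) ?_ ?_ (by omega) ?_
    · intro b c hbc X hX Y hY hsX hsY
      have hX0 : X.Nonempty := card_pos.1 (by omega)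
      obtain ⟨x, hx, hxY⟩ := IsUniform.exists_degree_ge hbc.2.2.2.1 hbc.2.2.2.2 hX hY hX0
        (hpart _ _ s b.2 hsX s1) (hpart _ _ s c.2 hsY s1)
      have hY0 : (0 : ℝ) < Y.card := by exact_mod_cast (by omega : 0 < Y.card)
      have hpos : (0 : ℝ) < ((Y.filter fun y => G.Adj x y).card : ℝ) :=
        lt_of_lt_of_le (by positivity) hxY
      obtain ⟨y, hy⟩ := card_pos.1 (by exact_mod_cast hpos)
      rw [mem_filter] at hy
      exact ⟨x, hx, y, hy.1, hy.2⟩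
    · intro b c hbc X hX Y hY hsX hsY
      have hX0 : X.Nonempty := card_pos.1 (by omega)
      have hh' : θ ^ 2 * ((w : ℝ) + 1) ≤ h := by
        refine le_trans ?_ h1
        gcongr
        linarith
      obtain ⟨x, hx, hxY⟩ := IsUniform.exists_degree_ge hbc.2.2.2.1 hbc.2.2.2.2 hX hY hX0
        (hpart _ _ s b.2 hsX s1) (hpart _ _ h c.2 hsY hh')
      refine ⟨x, hx, ?_⟩
      have e1 : (h : ℝ) ≤ Y.card := by exact_mod_cast hsY
      have e2 : (d - ε₀) * (ε / 20 * (w + 1)) ≤ (d - ε₀) * Y.card := by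
        gcongr
        linarith
      have e3 : (2 : ℝ) * s ≤ ((Y.filter fun y => G.Adj x y).card : ℝ) := by
        linarith
      exact_mod_cast e3
    · intro b hb
      refine (htdeg b (mem_filter.1 hb).1).trans (card_le_card ?_)
      intro c hc
      exact mem_filter.2 ⟨hnbr a b hb hc, (mem_filter.1 hc).2⟩
    · have e1 : (m : ℝ) * (w + 1) ≤ t * cap * (w + 1) := by
        have b1 : (1 + ε / 2) * m * ((1 - ε / 4) * (w + 1)) ≤ (t * (w + 1)) * cap := by
          gcongr
        have b2 : (1 : ℝ) ≤ (1 + ε / 2) * (1 - ε / 4) := by nlinarith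
        have b3 : (1 : ℝ) * (m * (w + 1)) ≤ (1 + ε / 2) * (1 - ε / 4) * (m * (w + 1)) := by
          gcongr
        linarith
      exact_mod_cast le_of_mul_le_mul_right e1 hw1
    · intro b
      have e1 : (2 : ℝ) * (K : ℝ) ^ 2 + cap + 1 + 2 * s + h ≤ w := by linarith
      have e2 : 2 * K ^ 2 + cap + 1 + 2 * s + h ≤ w := by exact_mod_cast e1
      have e3 := hwlow b.1 b.2
      omega
  let part : α → P.parts := fun x => ⟨P.part x, by simp⟩
  have hpart : ∀ x, x ∈ (part x).1 := fun x => by simp [part]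
  have hpart' : ∀ x (b : P.parts), x ∈ b.1 ↔ part x = b := by
    intro x b
    rw [← P.part_eq_iff_mem b.2, Subtype.ext_iff]
  obtain ⟨φ, hφ⟩ := exists_injective_nat R.ConnectedComponent
  -- Vertices are labelled by the component of their part, and `E` collects the bad parts. Edges
  -- between different labels outside `E` therefore lie in irregular or sparse pairs.
  let f : α → ℕ := fun x => φ (R.connectedComponentMk (part x))
  have hf : ∀ x y, f x = f y ↔ R.Reachable (part x) (part y) := by
    intro x y
    rw [← ConnectedComponent.eq]
    exact hφ.eq_iff
  let E : Finset α := univ.filter fun x => part x ∉ D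
  have hE : ∀ x, x ∉ E ↔ part x ∈ D := by intro x; simp [E]
  have hcardU : ∀ A : Finset P.parts, (univ.filter fun x => part x ∈ A).card =
      ∑ b ∈ A, b.1.card := by
    intro A
    rw [← card_biUnion (s := A) (t := fun b : P.parts => b.1)
      fun b _ c _ hbc => P.disjoint b.2 c.2 fun h => hbc (Subtype.ext h)]
    congr 1
    ext x
    simp [hpart']
  have hupper : ∀ A : Finset P.parts, ((univ.filter fun x => part x ∈ A).card : ℝ) ≤
      A.card * (w + 1) := by
    intro A
    rw [hcardU]
    exact_mod_cast sum_le_card_nsmul A _ (w + 1) fun b _ => hwhigh b.1 b.2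
  have hlower : ∀ A : Finset P.parts, (A.card : ℝ) * w ≤
      ((univ.filter fun x => part x ∈ A).card : ℝ) := by
    intro A
    rw [hcardU]
    exact_mod_cast card_nsmul_le_sum A _ w fun b _ => hwlow b.1 b.2
  refine ⟨E, f, ?_, ?_, ?_⟩
  · have h1 : E = univ.filter fun x => part x ∈ Dᶜ := by ext x; simp [E]
    rw [h1]
    refine (hupper _).trans ?_
    have h2 := card_bad_parts_le hθ0 hε₀ hPu
    calc ((Dᶜ).card : ℝ) * (w + 1) ≤ θ * k * (w + 1) := by gcongr
      _ = θ * (k * (w + 1)) := by ring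
      _ ≤ θ * (20 * m) := by gcongr
      _ = 20 * θ * m := by ring
      _ ≤ γ * m := by
        gcongr
        rw [hθ]
        nlinarith
  · refine (card_edges_outside_clusterGraph_le (θ := θ) (d := d) hd0.le hε₀0 hPu hPe _ ?_).trans ?_
    · intro x hx
      simp only [mem_filter, mem_univ, true_and] at hx
      obtain ⟨h1, h2, h3, h4⟩ := hx
      refine ⟨h4, part x.1, part x.2, ?_, (hE _).1 h1, (hE _).1 h2, hpart _, hpart _, ?_⟩
      · intro heq
        exact h3 ((hf _ _).2 (heq ▸ Reachable.refl _))
      · exact fun hadj => h3 ((hf _ _).2 hadj.reachable)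
    · have h1 : (N : ℝ) ≤ 10 * m := by exact_mod_cast hN
      calc 4 * (ε₀ + d) * (N : ℝ) ^ 2 ≤ 4 * (ε₀ + d) * (10 * m) ^ 2 := by gcongr
        _ = 400 * (ε₀ + d) * m ^ 2 := by ring
        _ ≤ γ * m ^ 2 := by
          gcongr
          linarith
  · intro x hx
    have hxD : part x ∈ D := (hE x).1 hx
    have h1 : (univ.filter fun y => y ∉ E ∧ f y = f x) =
        univ.filter fun y => part y ∈ S (part x) := by
      ext y
      simp only [mem_filter, mem_univ, true_and, S, hE, hf]
      exact and_congr_right fun _ => ⟨Reachable.symm, Reachable.symm⟩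
    rw [h1]
    constructor
    · refine le_trans ?_ (hlower _)
      have h2 := hRdeg _ hxD
      have h3 : ((univ.filter fun b => R.Adj (part x) b).card : ℝ) ≤ (S (part x)).card := by
        exact_mod_cast card_le_card
          (hnbr (part x) (part x) (mem_filter.2 ⟨hxD, Reachable.refl _⟩))
      have h4 : (1 + 0.9 * ε) * m ≤ (S (part x)).card * ((w : ℝ) + 1) :=
        h2.trans (by gcongr)
      have h5 : (1 - ε / 10) * ((w : ℝ) + 1) ≤ w := by
        rw [div_le_iff₀ hw1] at a4
        linarith
      calc (1 + ε / 2) * (m : ℝ) ≤ (1 - ε / 10) * ((1 + 0.9 * ε) * m) := by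
            rw [← mul_assoc]
            gcongr
            nlinarith
        _ ≤ (1 - ε / 10) * ((S (part x)).card * ((w : ℝ) + 1)) := by
            gcongr
            linarith
        _ = (S (part x)).card * ((1 - ε / 10) * ((w : ℝ) + 1)) := by ring
        _ ≤ _ := by gcongr
    · refine (hupper _).trans ?_
      have h2 : ((S (part x)).card : ℝ) ≤ 2 * t := by exact_mod_cast (hSsmall _ hxD).le
      calc ((S (part x)).card : ℝ) * (w + 1) ≤ 2 * t * (w + 1) := by gcongr
        _ ≤ _ := by linarith

/-! ### A blue fan across the pieces. -/

/-- If the red graph has few edges between the classes of a vertex labelling, and the classes are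
not too large, then the blue graph contains a fan. -/
theorem fanGraph_isContained_of_sparse_partition {α : Type*} [Fintype α] [DecidableEq α]
    {R B : SimpleGraph α} [DecidableRel R.Adj] (hRB : ∀ x y, x ≠ y → ¬ B.Adj x y → R.Adj x y)
    {η γ : ℝ} (hη : 0 < η) (hη1 : η ≤ 1) (hγ : γ = η ^ 2 / 20) {m n : ℕ} (hm : 0 < m)
    (hmn : m ≤ n) (hn : 8 / η ≤ n) (hcard : 2 * m ≤ Fintype.card α) (E : Finset α) (f : α → ℕ)
    (hE : (E.card : ℝ) ≤ γ * m)
    (hcross : (((univ : Finset (α × α)).filter fun x => x.1 ∉ E ∧ x.2 ∉ E ∧ f x.1 ≠ f x.2 ∧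
      R.Adj x.1 x.2).card : ℝ) ≤ γ * m ^ 2)
    (hone : ∀ x ∉ E, (2 + η) * n + ((univ.filter fun y => y ∉ E ∧ f y = f x).card : ℝ) ≤
      Fintype.card α)
    (htwo : ∀ x ∉ E, ∀ z ∉ E, f x ≠ f z → (1 + η) * n +
      ((univ.filter fun y => y ∉ E ∧ f y = f x).card : ℝ) +
      ((univ.filter fun y => y ∉ E ∧ f y = f z).card : ℝ) ≤ Fintype.card α) :
    (fanGraph n).IsContained B := by
  classical
  set X := (univ : Finset (α × α)).filter fun x => x.1 ∉ E ∧ x.2 ∉ E ∧ f x.1 ≠ f x.2 ∧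
      R.Adj x.1 x.2 with hX
  have hm0 : (0 : ℝ) < m := by exact_mod_cast hm
  have hmn' : (m : ℝ) ≤ n := by exact_mod_cast hmn
  have hn0 : (0 : ℝ) < n := lt_of_lt_of_le hm0 hmn'
  have hγ0 : 0 < γ := by rw [hγ]; positivity
  have hγη : γ ≤ η / 20 := by rw [hγ]; nlinarith
  have hcard' : 2 * (m : ℝ) ≤ Fintype.card α := by exact_mod_cast hcard
  have hm2 : γ * (m : ℝ) ^ 2 ≤ γ * n * n := by rw [mul_assoc, sq]; gcongr
  have hγm : γ * (m : ℝ) ≤ η / 20 * n := by gcongr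
  have hpairs : ∀ (I : Finset α) (Y : α → Finset α), (∀ x ∈ I, ∀ y ∈ Y x, (x, y) ∈ X) →
      ∑ x ∈ I, ((Y x).card : ℝ) ≤ γ * m ^ 2 := by
    intro I Y hIY
    refine le_trans ?_ hcross
    rw [← Nat.cast_sum, ← card_sigma]
    refine Nat.cast_le.2 (card_le_card_of_injOn (fun x => (x.1, x.2)) ?_ ?_)
    · rintro ⟨x, y⟩ hxy
      rw [mem_coe, mem_sigma] at hxy
      exact hIY x hxy.1 y hxy.2
    · rintro ⟨x, y⟩ - ⟨x', y'⟩ - h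
      simp only [Prod.mk.injEq] at h
      obtain ⟨rfl, rfl⟩ := h
      rfl
  -- a vertex with few red edges leaving its class
  let C : α → Finset α := fun v => univ.filter fun y => (v, y) ∈ X
  obtain ⟨v, hvE, hvC⟩ : ∃ v ∉ E, ((C v).card : ℝ) ≤ γ * m := by
    by_contra hcon
    push Not at hcon
    have h1 := hpairs Eᶜ C fun x _ y hy => (mem_filter.1 hy).2
    have h2 : ((Eᶜ).card : ℝ) = Fintype.card α - E.card := by
      rw [card_compl, Nat.cast_sub (card_le_univ E)]
    have h3 : (m : ℝ) ≤ (Eᶜ).card := by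
      rw [h2]
      nlinarith
    have h4 : (Eᶜ).Nonempty := by
      rw [← card_pos]
      exact_mod_cast hm0.trans_le h3
    have h5 := sum_lt_sum_of_nonempty h4 fun x hx => hcon x (mem_compl.1 hx)
    rw [sum_const, nsmul_eq_mul] at h5
    have h6 : m * (γ * m) ≤ (Eᶜ).card * (γ * (m : ℝ)) := by gcongr
    nlinarith
  let W : Finset α := univ.filter fun y => B.Adj v y ∧ y ∉ E ∧ f y ≠ f v
  by_contra hfan
  have hW : ¬ HasMatching B W n := fun h =>
    hfan (fanGraph_isContained_of_hasMatching (fun w hw => (mem_filter.1 hw).2.1) h)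
  have hcover : ∀ y, y ∈ W ∨ y ∈ E ∨ y ∈ C v ∨ (y ∉ E ∧ f y = f v) := by
    intro y
    by_cases h1 : y ∈ E
    · exact Or.inr (Or.inl h1)
    by_cases h2 : f y = f v
    · exact Or.inr (Or.inr (Or.inr ⟨h1, h2⟩))
    by_cases h3 : B.Adj v y
    · exact Or.inl (mem_filter.2 ⟨mem_univ _, h3, h1, h2⟩)
    · refine Or.inr (Or.inr (Or.inl (mem_filter.2 ⟨mem_univ _, ?_⟩)))
      rw [hX, mem_filter]
      exact ⟨mem_univ _, hvE, h1, Ne.symm h2, hRB v y (fun h => h2 (congrArg f h).symm) h3⟩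
  have hWcard : (2 + η / 2) * n ≤ (W.card : ℝ) := by
    have h1 : (univ : Finset α) ⊆ W ∪ (E ∪ (C v ∪ univ.filter fun y => y ∉ E ∧ f y = f v)) := by
      intro y _
      simpa only [mem_union, mem_filter, mem_univ, true_and] using hcover y
    have h2 := (card_le_card h1).trans ((card_union_le _ _).trans (Nat.add_le_add_left
      ((card_union_le _ _).trans (Nat.add_le_add_left (card_union_le _ _) _)) _))
    rw [card_univ] at h2
    have h3 : (Fintype.card α : ℝ) ≤ W.card + (E.card + ((C v).card +
        (univ.filter fun y => y ∉ E ∧ f y = f v).card)) := by exact_mod_cast h2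
    have h4 := hone v hvE
    have : 0 < η * n := by positivity
    linarith
  obtain ⟨r, hr, g, U, hg, hUW, hU, hUcard, hind, hdeg1⟩ := exists_matching_structure B W hW
  have hr' : (r : ℝ) ≤ n := by exact_mod_cast hr.le
  have hWmem : ∀ y ∈ W, y ∉ E ∧ f y ≠ f v := fun y hy => (mem_filter.1 hy).2.2
  have hUbig : η / 2 * n ≤ (U.card : ℝ) := by
    have : (U.card : ℝ) + 2 * r = W.card := by exact_mod_cast hUcard
    linarith
  have hηn : 0 < η * n := by positivity
  have hU0 : (0 : ℝ) < U.card := by nlinarith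
  have hXmem : ∀ x ∈ W, ∀ y ∈ W, f x ≠ f y → ¬ B.Adj x y → (x, y) ∈ X := by
    intro x hx y hy hxy hB
    rw [hX, mem_filter]
    exact ⟨mem_univ _, (hWmem x hx).1, (hWmem y hy).1, hxy,
      hRB x y (fun h => hxy (congrArg f h)) hB⟩
  -- most of the uncovered set lies in one class
  obtain ⟨x, hxU, hx⟩ : ∃ x ∈ U, ((U.filter fun y => f y ≠ f x).card : ℝ) ≤ η / 10 * n := by
    by_contra hcon
    push Not at hcon
    have h1 := hpairs U (fun x => U.filter fun y => f y ≠ f x) fun x hx y hy => by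
      rw [mem_filter] at hy
      exact hXmem x (hUW hx) y (hUW hy.1) (Ne.symm hy.2) (hind x hx y hy.1)
    have h2 := sum_lt_sum_of_nonempty (card_pos.1 (by exact_mod_cast hU0)) hcon
    rw [sum_const, nsmul_eq_mul] at h2
    have h3 : η / 2 * n * (η / 10 * n) ≤ U.card * (η / 10 * (n : ℝ)) := by gcongr
    have h4 : η / 2 * n * (η / 10 * n) = γ * n * n := by rw [hγ]; ring
    linarith
  let U₂ := U.filter fun y => f y = f x
  have hU₂ : η / 8 * n + 1 ≤ (U₂.card : ℝ) := by
    have h1 : (U₂.card : ℝ) + (U.filter fun y => f y ≠ f x).card = U.card := by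
      exact_mod_cast card_filter_add_card_filter_not (s := U) (fun y => f y = f x)
    have h2 : 8 ≤ n * η := by rwa [div_le_iff₀ hη] at hn
    linarith
  -- few matching edges avoid that class
  let I : Finset (Fin r) := univ.filter fun i => f (g (i, false)) ≠ f x ∧ f (g (i, true)) ≠ f x
  -- The first end of such an edge is red to all but at most one vertex of `U₂`, so it sends at
  -- least `η / 8 * n` crossing red edges; again `(η * 2 / 5) * (η / 8) = γ`.
  have hI : (I.card : ℝ) ≤ η * 2 / 5 * n := by
    have h1 := hpairs (I.image fun i => g (i, false)) (fun z => U₂.filter fun y => ¬ B.Adj z y) (by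
      intro z hz y hy
      obtain ⟨i, hi, rfl⟩ := mem_image.1 hz
      rw [mem_filter, mem_filter] at hy
      exact hXmem _ (hg.mem _) y (hUW hy.1.1) (by rw [hy.1.2]; exact (mem_filter.1 hi).2.1) hy.2)
    rw [sum_image fun i _ j _ hij => by simpa using hg.inj hij] at h1
    have h2 : ∀ i ∈ I, η / 8 * n ≤ ((U₂.filter fun y => ¬ B.Adj (g (i, false)) y).card : ℝ) := by
      intro i _
      have e1 := card_filter_add_card_filter_not (s := U₂) (fun y => B.Adj (g (i, false)) y)
      have e2 : (U₂.filter fun y => B.Adj (g (i, false)) y).card ≤ 1 :=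
        (card_le_card (filter_subset_filter _ (filter_subset _ _))).trans (hdeg1 i)
      have e3 : U₂.card ≤ (U₂.filter fun y => ¬ B.Adj (g (i, false)) y).card + 1 := by omega
      have e4 : (U₂.card : ℝ) ≤ (U₂.filter fun y => ¬ B.Adj (g (i, false)) y).card + 1 := by
        exact_mod_cast e3
      linarith
    have h3 := sum_le_sum h2
    rw [sum_const, nsmul_eq_mul] at h3
    have h4 : (I.card : ℝ) * (η / 8 * n) ≤ η * 2 / 5 * n * (η / 8 * n) := by
      calc (I.card : ℝ) * (η / 8 * n) ≤ γ * n * n := h3.trans (h1.trans hm2)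
        _ = _ := by rw [hγ]; ring
    exact le_of_mul_le_mul_right h4 (by positivity)
  -- A matching edge that meets the class of `x` contributes at most one vertex outside it; only
  -- edges in `I` contribute two.
  have hM : (univ.filter fun z : Fin r × Bool => f (g z) ≠ f x).card ≤ r + I.card := by
    rw [card_filter, Fintype.sum_prod_type, card_filter]
    have : r + ∑ i : Fin r, (if f (g (i, false)) ≠ f x ∧ f (g (i, true)) ≠ f x then 1 else 0) =
        ∑ i : Fin r, (1 + if f (g (i, false)) ≠ f x ∧ f (g (i, true)) ≠ f x then 1 else 0) := by
      rw [sum_add_distrib]; simp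
    rw [this]
    refine sum_le_sum fun i _ => ?_
    rw [Fintype.sum_bool]
    by_cases a : f (g (i, false)) = f x <;> by_cases b : f (g (i, true)) = f x <;> simp [a, b]
  have hup : ((W.filter fun y => f y ≠ f x).card : ℝ) ≤ η / 10 * n + (n + η * 2 / 5 * n) := by
    have h1 : (W.filter fun y => f y ≠ f x) ⊆ (U.filter fun y => f y ≠ f x) ∪
        (univ.filter fun z : Fin r × Bool => f (g z) ≠ f x).image g := by
      intro y hy
      rw [mem_filter] at hy
      by_cases hyg : y ∈ Set.range g
      · obtain ⟨z, rfl⟩ := hyg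
        exact mem_union_right _ (mem_image_of_mem _ (by simpa using hy.2))
      · exact mem_union_left _ (mem_filter.2 ⟨(hU y).2 ⟨hy.1, hyg⟩, hy.2⟩)
    have h2 := (card_le_card h1).trans ((card_union_le _ _).trans
      (Nat.add_le_add_left (card_image_le.trans hM) _))
    have h3 : ((W.filter fun y => f y ≠ f x).card : ℝ) ≤ (U.filter fun y => f y ≠ f x).card +
        (r + I.card) := by exact_mod_cast h2
    linarith
  have hxW := hWmem x (hUW hxU)
  have hlow : (1 + η * 9 / 10) * n ≤ ((W.filter fun y => f y ≠ f x).card : ℝ) := by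
    have h1 : (univ : Finset α) ⊆ (W.filter fun y => f y ≠ f x) ∪ (E ∪ (C v ∪
        ((univ.filter fun y => y ∉ E ∧ f y = f v) ∪
          univ.filter fun y => y ∉ E ∧ f y = f x))) := by
      intro y _
      simp only [mem_union, mem_filter, mem_univ, true_and]
      have h1 := hcover y
      have h2 : y ∈ W → y ∉ E := fun h => (hWmem y h).1
      tauto
    have h2 := (card_le_card h1).trans ((card_union_le _ _).trans (Nat.add_le_add_left
      ((card_union_le _ _).trans (Nat.add_le_add_left ((card_union_le _ _).trans
        (Nat.add_le_add_left (card_union_le _ _) _)) _)) _))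
    rw [card_univ] at h2
    have h3 : (Fintype.card α : ℝ) ≤ (W.filter fun y => f y ≠ f x).card + (E.card + ((C v).card +
        ((univ.filter fun y => y ∉ E ∧ f y = f v).card +
          (univ.filter fun y => y ∉ E ∧ f y = f x).card))) := by exact_mod_cast h2
    have h4 := htwo v hvE x hxW.1 (Ne.symm hxW.2)
    linarith
  linarith

/-- The classes of a labelling sum to at most the whole for three different labels. -/
theorem card_classes_add_le {α : Type*} [Fintype α] [DecidableEq α] (E : Finset α) (f : α → ℕ)
    {a b c : ℕ} (hab : a ≠ b) (hac : a ≠ c) (hbc : b ≠ c) :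
    (univ.filter fun y => y ∉ E ∧ f y = a).card + (univ.filter fun y => y ∉ E ∧ f y = b).card +
      (univ.filter fun y => y ∉ E ∧ f y = c).card ≤ Fintype.card α := by
  rw [← card_union_of_disjoint, ← card_union_of_disjoint]
  · exact card_le_univ _
  · rw [Finset.disjoint_left]
    intro y hy hy'
    simp only [mem_union, mem_filter, mem_univ, true_and] at hy hy'
    rcases hy with hy | hy
    · exact hac (hy.2.symm.trans hy'.2)
    · exact hbc (hy.2.symm.trans hy'.2)
  · rw [Finset.disjoint_left]
    intro y hy hy'
    simp only [mem_filter, mem_univ, true_and] at hy hy'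
    exact hab (hy.2.symm.trans hy'.2)

/-! ### The upper bound. -/

/-- The asymptotic upper bound for both ratios of cycle length and fan size. -/
theorem exists_ramseyArrows {ε : ℝ} (hε : 0 < ε) (hε1 : ε ≤ 1) :
    ∃ n₀ : ℕ, ∀ n ≥ n₀, ∀ m N : ℕ, N ≤ 10 * m →
      (m = n ∧ (4 + ε) * n ≤ N) ∨ (2 * m = n ∧ (3 + ε) * n ≤ N) →
      RamseyArrows (cycleGraph (2 * m)) (fanGraph n) N := by
  classical
  -- The partition is applied with `ε / 8`, so pieces have size at least `(1 + ε / 16) * m = (1 + η)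
  -- * m`, the surplus needed from a third piece.
  set η : ℝ := ε / 16 with hη
  set γ : ℝ := η ^ 2 / 20 with hγ
  have hη0 : 0 < η := by positivity
  have hγ0 : 0 < γ := by positivity
  have hγη : γ ≤ η / 20 := by rw [hγ]; nlinarith
  obtain ⟨m₀, hm₀⟩ := exists_sparse_partition (ε := ε / 8) (γ := γ) (by positivity) (by linarith)
    hγ0 (by linarith)
  obtain ⟨n₁, hn₁⟩ := exists_nat_ge (8 / η)
  refine ⟨2 * m₀ + n₁ + 4, fun n hn m N hN hcase C => ?_⟩
  have hmm : m₀ ≤ m := by omega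
  have hm2 : 2 ≤ m := by omega
  have hmn : m ≤ n := by omega
  have hm0 : (0 : ℝ) < m := by exact_mod_cast (by omega : 0 < m)
  have hnη : 8 / η ≤ n := hn₁.trans (by exact_mod_cast (by omega : n₁ ≤ n))
  have hnη' : 8 ≤ n * η := by rwa [div_le_iff₀ hη0] at hnη
  have hmn' : (m : ℝ) ≤ n := by exact_mod_cast hmn
  have hn0 : (0 : ℝ) < n := hm0.trans_le hmn'
  have hεn : 128 ≤ ε * n := by rw [hη] at hnη'; linarith
  by_contra hcon
  rw [not_or] at hcon
  obtain ⟨hR, hB⟩ := hcon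
  set R := C.labelGraph 1 with hRdef
  set B := C.labelGraph 0 with hBdef
  have hRB : ∀ x y, x ≠ y → ¬ B.Adj x y → R.Adj x y := by
    intro x y hxy h
    rw [TopEdgeLabeling.labelGraph_adj] at h ⊢
    refine ⟨hxy, ?_⟩
    have h1 : C.get x y hxy ≠ 0 := fun h0 => h ⟨hxy, h0⟩
    omega
  have hdegB : ∀ x, (univ.filter fun y => B.Adj x y).card ≤ 2 * n + m := by
    intro x
    by_contra hlt
    refine hR (cycleGraph_isContained_of_not_hasMatching hRB hm2 hmn
      (univ.filter fun y => B.Adj x y) (by omega) fun h => hB ?_)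
    exact fanGraph_isContained_of_hasMatching (fun w hw => (mem_filter.1 hw).2) h
  have hdegR : ∀ x, (1 + ε / 8) * m ≤ (R.degree x : ℝ) := by
    intro x
    have h1 : (univ : Finset (Fin N)) ⊆
        R.neighborFinset x ∪ ((univ.filter fun y => B.Adj x y) ∪ {x}) := by
      intro y _
      simp only [mem_union, mem_neighborFinset, mem_filter, mem_univ, true_and, mem_singleton]
      by_cases hxy : x = y
      · exact Or.inr (Or.inr hxy.symm)
      · by_cases hBxy : B.Adj x y
        · exact Or.inr (Or.inl hBxy)
        · exact Or.inl (hRB x y hxy hBxy)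
    have h2 := (card_le_card h1).trans ((card_union_le _ _).trans
      (Nat.add_le_add_left (card_union_le _ _) _))
    rw [card_univ, Fintype.card_fin, card_neighborFinset_eq_degree, card_singleton] at h2
    have h3 := hdegB x
    have h4 : N ≤ R.degree x + (2 * n + m + 1) := by omega
    have h5 : (N : ℝ) ≤ R.degree x + (2 * n + m + 1) := by exact_mod_cast h4
    rcases hcase with ⟨rfl, hc⟩ | ⟨hmn2, hc⟩
    · linarith
    · have : (2 : ℝ) * m = n := by exact_mod_cast hmn2
      rw [← this] at hc hεn h5
      nlinarith
  obtain ⟨E, f, hE, hcross, hsize⟩ := hm₀ m hmm (Fin N) R (by simpa using hN) hdegR hR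
  have hγm : γ * m ≤ η / 20 * n := by gcongr
  refine hB (fanGraph_isContained_of_sparse_partition hRB hη0 (by linarith) hγ (by omega) hmn hnη
    ?_ E f hE hcross ?_ ?_)
  · rw [Fintype.card_fin]
    have : 2 * (m : ℝ) ≤ N := by
      rcases hcase with ⟨rfl, hc⟩ | ⟨hmn2, hc⟩
      · linarith
      · have : (2 : ℝ) * m = n := by exact_mod_cast hmn2
        linarith
    exact_mod_cast this
  · intro x hx
    have h1 := (hsize x hx).2
    rw [Fintype.card_fin]
    rcases hcase with ⟨rfl, hc⟩ | ⟨hmn2, hc⟩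
    · nlinarith
    · have : (2 : ℝ) * m = n := by exact_mod_cast hmn2
      have h2 : 2 * (1 + ε / 8) * (m : ℝ) = (1 + ε / 8) * n := by rw [← this]; ring
      nlinarith
  · intro x hx z hz hxz
    have h1 := (hsize x hx).2
    have h2 := (hsize z hz).2
    rw [Fintype.card_fin]
    rcases hcase with ⟨rfl, hc⟩ | ⟨hmn2, hc⟩
    -- When `m = n`, two pieces and `E` cover fewer than `(4 + ε) * n` vertices, so a third piece
    -- exists; it alone supplies the required `(1 + η) * n` vertices.
    · obtain ⟨y, hyE, hyx, hyz⟩ : ∃ y, y ∉ E ∧ f y ≠ f x ∧ f y ≠ f z := by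
        by_contra hno
        push Not at hno
        have h3 : (univ : Finset (Fin N)) ⊆ E ∪ ((univ.filter fun y => y ∉ E ∧ f y = f x) ∪
            univ.filter fun y => y ∉ E ∧ f y = f z) := by
          intro y _
          simp only [mem_union, mem_filter, mem_univ, true_and]
          have := hno y
          tauto
        have h4 := (card_le_card h3).trans ((card_union_le _ _).trans
          (Nat.add_le_add_left (card_union_le _ _) _))
        rw [card_univ, Fintype.card_fin] at h4
        have h5 : (N : ℝ) ≤ E.card + ((univ.filter fun y => y ∉ E ∧ f y = f x).card +
          (univ.filter fun y => y ∉ E ∧ f y = f z).card) := by exact_mod_cast h4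
        nlinarith
      have h3 := card_classes_add_le E f hxz (Ne.symm hyx) (Ne.symm hyz)
      rw [Fintype.card_fin] at h3
      have h4 : ((univ.filter fun y => y ∉ E ∧ f y = f x).card : ℝ) +
          (univ.filter fun y => y ∉ E ∧ f y = f z).card +
          (univ.filter fun w => w ∉ E ∧ f w = f y).card ≤ N := by exact_mod_cast h3
      have h5 := (hsize y hyE).1
      have h6 : (1 + ε / 8 / 2) * (m : ℝ) = (1 + η) * m := by rw [hη]; ring
      linarith
    · have : (2 : ℝ) * m = n := by exact_mod_cast hmn2
      have h3 : 2 * (1 + ε / 8) * (m : ℝ) = (1 + ε / 8) * n := by rw [← this]; ring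
      nlinarith

/-! ### From bounds to asymptotics. -/

/-- A sequence eventually within `o(n)` of `c * n` along `p` has the form `(c + ε n) * n`. -/
theorem exists_tendsto_zero_of_bounds (a : ℕ → ℕ) (p : ℕ → Prop) (c : ℝ)
    (hup : ∀ ε : ℝ, 0 < ε → ε ≤ 1 → ∀ᶠ n : ℕ in Filter.atTop, p n → (a n : ℝ) ≤ (c + ε) * n + 1)
    (hlow : ∀ᶠ n : ℕ in Filter.atTop, p n → c * n - 2 ≤ a n) :
    ∃ ε : ℕ → ℝ, Filter.Tendsto ε Filter.atTop (nhds 0) ∧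
      ∀ᶠ n : ℕ in Filter.atTop, p n → (a n : ℝ) = (c + ε n) * (n : ℝ) := by
  classical
  -- The value 0 off `p` makes the sequence converge along all `n`. Taking `n > 4 / δ` absorbs the
  -- additive errors 1 and 2.
  refine ⟨fun n => if p n then (a n : ℝ) / n - c else 0, ?_, ?_⟩
  · rw [Metric.tendsto_atTop']
    intro δ hδ
    set ε : ℝ := min (δ / 2) 1 with hε
    have hε0 : 0 < ε := lt_min (by positivity) one_pos
    have hεδ : ε ≤ δ / 2 := min_le_left _ _
    obtain ⟨n₀, hn₀⟩ := exists_nat_gt (4 / δ)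
    obtain ⟨N, hN⟩ := Filter.eventually_atTop.1 ((hup ε hε0 (min_le_right _ _)).and hlow)
    refine ⟨N + n₀, fun n hn => ?_⟩
    rw [dist_zero_right, Real.norm_eq_abs]
    split_ifs with hp
    · obtain ⟨h1, h2⟩ := hN n (by omega)
      have h1 := h1 hp
      have h2 := h2 hp
      have hn1 : 4 / δ < n := hn₀.trans_le (by exact_mod_cast (by omega : n₀ ≤ n))
      have hn0 : (0 : ℝ) < n := lt_trans (by positivity) hn1
      have hn2 : 4 < n * δ := by rwa [div_lt_iff₀ hδ] at hn1
      have hεn : ε * n ≤ δ / 2 * n := by gcongr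
      rw [abs_lt]
      constructor
      · rw [lt_sub_iff_add_lt, lt_div_iff₀ hn0]
        nlinarith
      · rw [sub_lt_iff_lt_add, div_lt_iff₀ hn0]
        nlinarith
    · simpa using hδ
  · filter_upwards [Filter.eventually_gt_atTop 0] with n hn hp
    have hn0 : (n : ℝ) ≠ 0 := by positivity
    rw [if_pos hp]
    field_simp
    ring

theorem ramseyNumber_le_of_arrows {α β : Type*} {F : SimpleGraph α} {H : SimpleGraph β} {N : ℕ}
    (hN : 0 < N) (h : RamseyArrows F H N) : ramseyNumber F H ≤ N := Nat.sInf_le ⟨hN, h⟩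

/-- The arrowing `N` keeps the set nonempty, since otherwise `sInf` would be 0. Excluding every `k ≤
M` avoids appealing to monotonicity of arrowing. -/
theorem lt_ramseyNumber_of_not_arrows {α β : Type*} {F : SimpleGraph α} {H : SimpleGraph β}
    {N M : ℕ} (hN : 0 < N) (h : RamseyArrows F H N) (hM : ∀ k ≤ M, ¬ RamseyArrows F H k) :
    M < ramseyNumber F H := by
  have hmem : ramseyNumber F H ∈ {N : ℕ | 0 < N ∧ RamseyArrows F H N} := Nat.sInf_mem ⟨N, hN, h⟩
  by_contra hle
  exact hM _ (not_lt.1 hle) hmem.2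

/-- Both bounds for the Ramsey number of a cycle of length `2 m` versus `F_n`. -/
theorem exists_ramseyNumber_bounds {ε : ℝ} (hε : 0 < ε) (hε1 : ε ≤ 1) :
    ∃ n₀ : ℕ, ∀ n ≥ n₀, ∀ m b : ℕ, (m = n ∧ b = 0) ∨ (2 * m = n ∧ b = 1) →
      (ramseyNumber (cycleGraph (2 * m)) (fanGraph n) : ℝ) ≤ (4 - b + ε) * n + 1 ∧
      (4 - b : ℝ) * n - 2 ≤ ramseyNumber (cycleGraph (2 * m)) (fanGraph n) := by
  obtain ⟨n₀, hn₀⟩ := exists_ramseyArrows hε hε1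
  refine ⟨n₀ + 4, fun n hn m b hcase => ?_⟩
  have hn0 : (4 : ℝ) ≤ n := by exact_mod_cast (by omega : 4 ≤ n)
  have hb : (b : ℝ) ≤ 1 := by exact_mod_cast (by omega : b ≤ 1)
  have hx0 : 0 < (4 - b + ε) * (n : ℝ) := by
    have : (0 : ℝ) < 4 - b + ε := by linarith
    positivity
  set N := ⌈(4 - b + ε) * (n : ℝ)⌉₊ with hN
  have hN1 : (4 - b + ε) * (n : ℝ) ≤ N := Nat.le_ceil _
  have hN2 : (N : ℝ) < (4 - b + ε) * n + 1 := Nat.ceil_lt_add_one hx0.le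
  have hN0 : 0 < N := Nat.ceil_pos.2 hx0
  have harr : RamseyArrows (cycleGraph (2 * m)) (fanGraph n) N := by
    refine hn₀ n (by omega) m N ?_ ?_
    · have : (N : ℝ) ≤ 10 * m := by
        rcases hcase with ⟨rfl, rfl⟩ | ⟨h, rfl⟩
        · norm_num at hN2
          nlinarith
        · have h' : (2 : ℝ) * m = n := by exact_mod_cast h
          norm_num at hN2
          nlinarith
      exact_mod_cast this
    · rcases hcase with ⟨rfl, rfl⟩ | ⟨h, rfl⟩
      · left
        norm_num at hN1
        exact ⟨rfl, hN1⟩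
      · right
        norm_num at hN1
        exact ⟨h, hN1⟩
  refine ⟨(Nat.cast_le.2 (ramseyNumber_le_of_arrows hN0 harr)).trans hN2.le, ?_⟩
  -- The colouring has `4 * n - 2` vertices for `b = 0` and `3 * n - 3` for `b = 1`.
  have h1 := lt_ramseyNumber_of_not_arrows (M := (b + 2) * (2 * m - 1)) hN0 harr fun k hk =>
    not_ramseyArrows_of_le (b := b) (by omega) hk (by omega) (by
      rcases hcase with ⟨rfl, rfl⟩ | ⟨h, rfl⟩ <;> omega)
  rcases hcase with ⟨rfl, rfl⟩ | ⟨h, rfl⟩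
  · have h2 : 4 * m ≤ ramseyNumber (cycleGraph (2 * m)) (fanGraph m) + 2 := by omega
    have h3 : 4 * (m : ℝ) ≤ ramseyNumber (cycleGraph (2 * m)) (fanGraph m) + 2 := by
      exact_mod_cast h2
    norm_num
    linarith
  · have h2 : 3 * n ≤ ramseyNumber (cycleGraph (2 * m)) (fanGraph n) + 2 := by omega
    have h3 : 3 * (n : ℝ) ≤ ramseyNumber (cycleGraph (2 * m)) (fanGraph n) + 2 := by
      exact_mod_cast h2
    norm_num
    linarith

end CycleFan

theorem mainTheorem2 :
    (∃ ε : ℕ → ℝ, Filter.Tendsto ε Filter.atTop (nhds 0) ∧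
      ∀ᶠ n : ℕ in Filter.atTop,
        (ramseyNumber (SimpleGraph.cycleGraph (2 * n)) (fanGraph n) : ℝ) = (4 + ε n) * (n : ℝ)) ∧
    (∃ ε : ℕ → ℝ, Filter.Tendsto ε Filter.atTop (nhds 0) ∧
      ∀ᶠ n : ℕ in Filter.atTop, Even n →
        (ramseyNumber (SimpleGraph.cycleGraph n) (fanGraph n) : ℝ) = (3 + ε n) * (n : ℝ)) := by
  constructor
  · obtain ⟨ε, hε, h⟩ := CycleFan.exists_tendsto_zero_of_bounds
      (fun n => ramseyNumber (SimpleGraph.cycleGraph (2 * n)) (fanGraph n)) (fun _ => True) 4 (by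
        intro ε hε hε1
        obtain ⟨n₀, hn₀⟩ := CycleFan.exists_ramseyNumber_bounds hε hε1
        filter_upwards [Filter.eventually_ge_atTop n₀] with n hn _
        simpa using (hn₀ n hn n 0 (Or.inl ⟨rfl, rfl⟩)).1) (by
        -- The lower bound does not involve `ε`, so any admissible value serves.
        obtain ⟨n₀, hn₀⟩ := CycleFan.exists_ramseyNumber_bounds one_pos le_rfl
        filter_upwards [Filter.eventually_ge_atTop n₀] with n hn _
        simpa using (hn₀ n hn n 0 (Or.inl ⟨rfl, rfl⟩)).2)
    exact ⟨ε, hε, h.mono fun n hn => hn trivial⟩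
  · refine CycleFan.exists_tendsto_zero_of_bounds
      (fun n => ramseyNumber (SimpleGraph.cycleGraph n) (fanGraph n)) Even 3 ?_ ?_
    · intro ε hε hε1
      obtain ⟨n₀, hn₀⟩ := CycleFan.exists_ramseyNumber_bounds hε hε1
      filter_upwards [Filter.eventually_ge_atTop n₀] with n hn hev
      obtain ⟨m, rfl⟩ := hev.two_dvd
      have := (hn₀ (2 * m) hn m 1 (Or.inr ⟨rfl, rfl⟩)).1
      norm_num at this ⊢
      exact this
    · obtain ⟨n₀, hn₀⟩ := CycleFan.exists_ramseyNumber_bounds one_pos le_rfl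
      filter_upwards [Filter.eventually_ge_atTop n₀] with n hn hev
      obtain ⟨m, rfl⟩ := hev.two_dvd
      have := (hn₀ (2 * m) hn m 1 (Or.inr ⟨rfl, rfl⟩)).2
      norm_num at this ⊢
      exact this
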